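/- Let $\Bbbk$ be a field. All groupoids are small; $\mathcal G(x,y)$ denotes the set of arrows from $x$ to $y$, $fg$ denotes the composite "$f$ after $g$", and $\Bbbk S$ is the $\Bbbk$-vector space with basis the set $S$. The path algebra of a small category $\mathcal D$ is $\bigoplus_{x,x'}\Bbbk\mathcal D(x,x')$, with product given on arrows by the composition when it is defined and by $0$ otherwise; $1_x$ is the idempotent given by the identity arrow of $x$. A left module $M$ over such an algebra $R$ is unital if $RM=M$; finite generation and projectivity refer to the category of unital left modules. Let $\varphi\colon\mathcal H\to\mathcal G$ be a morphism of groupoids (a functor). Write $\mathrm{Rep}_\Bbbk(\mathcal G)$ for the category of functors from $\mathcal G$ to $\Bbbk$-vector spaces. The induction functor $\varphi^*\colon \mathrm{Rep}_\Bbbk(\mathcal H)\to\mathrm{Rep}_\Bbbk(\mathcal G)$ sends $\mathcal W$ to $x\mapsto \mathrm{Nat}(\mathcal G(x,\varphi(-)),\mathcal W)$ (natural transformations of set-valued functors on $\mathcal H$), and the co-induction functor ${}^*\varphi$ sends $\mathcal W$ to $x\mapsto \varinjlim_{(a,u)}\mathcal W_u$, the colimit being over the groupoid of pairs $(a,u)$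 with $u\in\mathcal H_0$, $a\in\mathcal G(\varphi(u),x)$, whose arrows $(a,u)\to(a',u')$ are the $h\in\mathcal H(u,u')$ with $a=a'\varphi(h)$. The morphism $\varphi$ is called Frobenius if $\varphi^*$ and ${}^*\varphi$ are naturally isomorphic. Assume that $\varphi$ is injective on objects. Let $A$ and $B$ be the path algebras of $\mathcal H$ and $\mathcal G$; then $\varphi$ induces a homomorphism of (non-unital) algebras $A\to B$, through which $A$ acts on $B$. For $u\in\mathcal H_0$ let $B1_u$ denote $B1_{\varphi(u)}$, and let $\mathrm{Hom}_A(AB,A1_u)$ be the left $B$-module of homomorphisms of left $A$-modules with action $(bf)(m)=f(mb)$. Then the following three conditions are equivalent. (i) $\varphi$ is a Frobenius morphism. (ii) There is a natural transformation $E_{(u,v)}\colon\mathcal G(\varphi(u),\varphi(v))\to\Bbbk\mathcal H(u,v)$ of functors on $\mathcal H^{\mathrm{op}}\times\mathcal H$ and, for every $x\in\mathcal G_0$, a finite (possibly empty) family $((u_i,b_i),c_i)_{i=1,\dots,N}$ with $u_i\in\mathcal H_0$, $b_i\in\mathcal G(\varphi(u_i),x)$ and $c_i\in\Bbbk\mathcal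 G(x,\varphi(u_i))$ such that, for all $u\in\mathcal H_0$, $b\in\mathcal G(x,\varphi(u))$ and $b'\in\mathcal G(\varphi(u),x)$, $$\sum_i E(bb_i)\,c_i=b\in\Bbbk\mathcal G(x,\varphi(u)),\qquad b'=\sum_i b_i\,E(c_ib')\in\Bbbk\mathcal G(\varphi(u),x),$$ where $E$ is extended $\Bbbk$-linearly and elements of $\Bbbk\mathcal H(u,v)$ act through $\varphi$. (iii) For every $x\in\mathcal G_0$ the unital left $A$-module $AB1_x$ is finitely generated and projective, and there are isomorphisms of unital left $B$-modules $B1_u\cong B\,\mathrm{Hom}_A(AB,A1_u)$ for all $u\in\mathcal H_0$, natural in $u\in\mathcal H^{\mathrm{op}}$ (an arrow $h\colon u'\to u$ acts by right multiplication by $\varphi(h)$ on the left-hand side, and by composition with right multiplication $A1_u\to A1_{u'}$ by $h$ on the right-hand side). -/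

import Mathlib

open CategoryTheory CategoryTheory.Limits

universe u

noncomputable section

/-! ## Linearised hom-sets: `(x ⟶ y) →₀ k` is the vector space with basis the arrows `x ⟶ y` -/

section Linearised

variable (k : Type u) [Field k]

/-- The `k`-bilinear extension of the composition of arrows; `linComp k p q` is "`p` after `q`". -/
def linComp {C : Type u} [Category.{u} C] {x y z : C} :
    ((y ⟶ z) →₀ k) →ₗ[k] ((x ⟶ y) →₀ k) →ₗ[k] ((x ⟶ z) →₀ k) :=
  Finsupp.linearCombination k fun p : y ⟶ z =>
    Finsupp.linearCombination k fun q : x ⟶ y => Finsupp.single (q ≫ p) (1 : k)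

/-- The `k`-linear extension of the action of a functor on the arrows `x ⟶ y`. -/
def linMap {C D : Type u} [Category.{u} C] [Category.{u} D] (F : C ⥤ D) {x y : C} :
    ((x ⟶ y) →₀ k) →ₗ[k] ((F.obj x ⟶ F.obj y) →₀ k) :=
  Finsupp.linearCombination k fun p : x ⟶ y => Finsupp.single (F.map p) (1 : k)

end Linearised

/-! ## The path algebra of a small category -/

/-- All arrows of a small category, each with its source and its target. -/
abbrev Arr (C : Type u) [Category.{u} C] : Type u := Σ (x y : C), (x ⟶ y)

/-- The path algebra of a small category: the `k`-vector space whose basis is the set of all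
arrows, that is, the direct sum over all pairs of objects `(x, y)` of the spaces
`(x ⟶ y) →₀ k`. -/
def PathAlgebra (k : Type u) [Field k] (C : Type u) [Category.{u} C] : Type u := Arr C →₀ k

namespace PathAlgebra

variable (k : Type u) [Field k] {C D : Type u} [Category.{u} C] [Category.{u} D]

instance : AddCommGroup (PathAlgebra k C) := inferInstanceAs (AddCommGroup (Arr C →₀ k))

instance : Module k (PathAlgebra k C) := inferInstanceAs (Module k (Arr C →₀ k))

/-- The basis vector attached to an arrow. -/
def of {x y : C} (f : x ⟶ y) : PathAlgebra k C := Finsupp.single (⟨x, y, f⟩ : Arr C) (1 : k)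

/-- The idempotent `1_x` attached to an object `x`. -/
def idem (x : C) : PathAlgebra k C := of k (𝟙 x)

variable {k} in
/-- Linear maps out of the path algebra are determined by their values on arrows. -/
theorem linearMap_ext {M : Type*} [AddCommGroup M] [Module k M] {f g : PathAlgebra k C →ₗ[k] M}
    (h : ∀ (x y : C) (a : x ⟶ y), f (of k a) = g (of k a)) : f = g := by
  refine Finsupp.lhom_ext' (R := k) (M := k) (α := Arr C) fun a => ?_
  refine LinearMap.ext_ring ?_
  obtain ⟨x, y, a⟩ := a
  exact h x y a

open Classical in
/-- The product of two arrows `a`, `b`: the composite "`a` after `b`" if the source of `a` is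
the target of `b`, and zero otherwise. -/
def mulArr (a b : Arr C) : PathAlgebra k C :=
  if h : b.2.1 = a.1 then of k (b.2.2 ≫ eqToHom h ≫ a.2.2) else 0

/-- The multiplication of the path algebra, as a bilinear map. -/
def mulLin : PathAlgebra k C →ₗ[k] PathAlgebra k C →ₗ[k] PathAlgebra k C :=
  Finsupp.linearCombination k fun a : Arr C =>
    (Finsupp.linearCombination k fun b : Arr C => mulArr k a b :
      (Arr C →₀ k) →ₗ[k] PathAlgebra k C)

instance : Mul (PathAlgebra k C) := ⟨fun a b => mulLin k a b⟩

theorem mul_def (a b : PathAlgebra k C) : a * b = mulLin k a b := rfl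

theorem of_mul_of' {x y z w : C} (a : z ⟶ w) (b : x ⟶ y) :
    of k a * of k b = mulArr k ⟨z, w, a⟩ ⟨x, y, b⟩ := by
  rw [mul_def, mulLin, of, of]
  erw [Finsupp.linearCombination_single, one_smul, Finsupp.linearCombination_single, one_smul]

theorem of_mul_of {x y z : C} (a : y ⟶ z) (b : x ⟶ y) : of k a * of k b = of k (b ≫ a) := by
  rw [of_mul_of']
  simp [mulArr]

theorem of_mul_of_ne {x y z w : C} (a : z ⟶ w) (b : x ⟶ y) (h : y ≠ z) :
    of k a * of k b = 0 := by
  rw [of_mul_of']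
  simp [mulArr, h]

theorem of_mul_assoc {x y z w s t : C} (a : s ⟶ t) (b : z ⟶ w) (c : x ⟶ y) :
    of k a * of k b * of k c = of k a * (of k b * of k c) := by
  have zl : ∀ p : PathAlgebra k C, 0 * p = 0 := fun p => by simp [mul_def]
  have zr : ∀ p : PathAlgebra k C, p * 0 = 0 := fun p => by simp [mul_def]
  by_cases h₁ : w = s
  · subst h₁
    by_cases h₂ : y = z
    · subst h₂
      simp [of_mul_of]
    · rw [of_mul_of, of_mul_of_ne k _ _ h₂, of_mul_of_ne k _ _ h₂, zr]
  · rw [of_mul_of_ne k _ _ h₁, zl]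
    by_cases h₂ : y = z
    · subst h₂
      rw [of_mul_of, of_mul_of_ne k _ _ h₁]
    · rw [of_mul_of_ne k _ _ h₂, zr]

theorem mul_assoc' (a b c : PathAlgebra k C) : a * b * c = a * (b * c) := by
  have key : (LinearMap.compr₂ (mulLin k) (mulLin k) :
        PathAlgebra k C →ₗ[k] PathAlgebra k C →ₗ[k] PathAlgebra k C →ₗ[k] PathAlgebra k C) =
      ((LinearMap.llcomp k (PathAlgebra k C) (PathAlgebra k C) (PathAlgebra k C)).flip.comp
        (mulLin k)).flip.comp (mulLin k) := by
    refine linearMap_ext fun s t a => linearMap_ext fun z w b => linearMap_ext fun x y c => ?_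
    exact of_mul_assoc k a b c
  exact congrArg (fun L => L a b c) key

instance : NonUnitalRing (PathAlgebra k C) :=
  { (inferInstance : AddCommGroup (PathAlgebra k C)),
    (inferInstance : Mul (PathAlgebra k C)) with
    left_distrib := fun a b c => by simp [mul_def]
    right_distrib := fun a b c => by simp [mul_def]
    zero_mul := fun a => by simp [mul_def]
    mul_zero := fun a => by simp [mul_def]
    mul_assoc := mul_assoc' k }

instance : IsScalarTower k (PathAlgebra k C) (PathAlgebra k C) :=
  ⟨fun r a b => by
    change mulLin k (r • a) b = r • mulLin k a b
    simp⟩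

instance : SMulCommClass k (PathAlgebra k C) (PathAlgebra k C) :=
  ⟨fun r a b => by
    change r • mulLin k a b = mulLin k a (r • b)
    simp⟩

/-- The linear map between path algebras given on arrows by a functor. -/
def mapLin (F : C ⥤ D) : PathAlgebra k C →ₗ[k] PathAlgebra k D :=
  Finsupp.linearCombination k fun a : Arr C => of k (F.map a.2.2)

theorem mapLin_of (F : C ⥤ D) {x y : C} (a : x ⟶ y) :
    mapLin k F (of k a) = of k (F.map a) := by
  rw [mapLin, of]
  erw [Finsupp.linearCombination_single, one_smul]

/-- If a functor is injective on objects, the induced linear map between the path algebras is a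
homomorphism of (non-unital) `k`-algebras. -/
def map (F : C ⥤ D) (hF : Function.Injective F.obj) :
    PathAlgebra k C →ₙₐ[k] PathAlgebra k D :=
  { mapLin k F with
    map_zero' := by simp
    map_mul' := by
      intro a b
      change mapLin k F (mulLin k a b) = mulLin k (mapLin k F a) (mapLin k F b)
      have key : ((mulLin k).compr₂ (mapLin k F) :
            PathAlgebra k C →ₗ[k] PathAlgebra k C →ₗ[k] PathAlgebra k D) =
          (mulLin k).compl₁₂ (mapLin k F) (mapLin k F) := by
        refine linearMap_ext fun z w a => linearMap_ext fun x y b => ?_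
        change mapLin k F (of k a * of k b) = mapLin k F (of k a) * mapLin k F (of k b)
        rw [mapLin_of, mapLin_of]
        by_cases h : y = z
        · subst h
          rw [of_mul_of, of_mul_of, mapLin_of, F.map_comp]
        · rw [of_mul_of_ne k _ _ h, of_mul_of_ne k _ _ (fun h' => h (hF h')), map_zero]
      exact congrArg (fun L => L a b) key }

end PathAlgebra

/-! ## Left modules over not necessarily unital algebras -/

/-- A left module over a `k`-algebra `R` that need not have a unit: a `k`-vector space with a
`k`-bilinear associative left action of `R`. -/
structure LeftMod (k : Type u) [Field k] (R : Type u) [NonUnitalRing R] [Module k R] where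
  carrier : Type u
  [grp : AddCommGroup carrier]
  [mod : Module k carrier]
  act : R →ₙₐ[k] Module.End k carrier

namespace LeftMod

variable {k : Type u} [Field k] {R : Type u} [NonUnitalRing R] [Module k R]

instance : CoeSort (LeftMod k R) (Type u) := ⟨LeftMod.carrier⟩

instance (M : LeftMod k R) : AddCommGroup M := M.grp

instance (M : LeftMod k R) : Module k M := M.mod

/-- The `k`-vector space of homomorphisms of left `R`-modules. -/
def homs (M N : LeftMod k R) : Submodule k (M →ₗ[k] N) where
  carrier := {f | ∀ (r : R) (m : M), f (M.act r m) = N.act r (f m)}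
  add_mem' := fun hf hg r m => by simp [hf r m, hg r m]
  zero_mem' := fun r m => by simp
  smul_mem' := fun c f hf r m => by simp [hf r m]

/-- The module structure on a stable subspace. -/
def sub (M : LeftMod k R) (N : Submodule k M) (hN : ∀ r : R, ∀ n ∈ N, M.act r n ∈ N) :
    LeftMod k R where
  carrier := N
  act :=
    { toFun := fun r => (M.act r).restrict (hN r)
      map_smul' := fun c r => by ext n; simp
      map_zero' := by ext n; simp
      map_add' := fun r s => by ext n; simp
      map_mul' := fun r s => by ext n; simp }

/-- The left `R`-module on a subspace `N` of an algebra `T` that is stable under left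
multiplication by the image of a homomorphism `f : R → T` of non-unital algebras. -/
def ofSubspace {T : Type u} [NonUnitalRing T] [Module k T] [IsScalarTower k T T]
    [SMulCommClass k T T] (f : R →ₙₐ[k] T) (N : Submodule k T)
    (hN : ∀ r : R, ∀ n ∈ N, f r * n ∈ N) : LeftMod k R where
  carrier := N
  act :=
    { toFun := fun r => (LinearMap.mulLeft k (f r)).restrict (hN r)
      map_smul' := fun c r => LinearMap.ext fun n => Subtype.ext (by
        change f (c • r) * n.1 = c • (f r * n.1)
        rw [map_smul, smul_mul_assoc])
      map_zero' := LinearMap.ext fun n => Subtype.ext (by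
        change f 0 * n.1 = 0
        rw [map_zero, zero_mul])
      map_add' := fun r s => LinearMap.ext fun n => Subtype.ext (by
        change f (r + s) * n.1 = f r * n.1 + f s * n.1
        rw [map_add, add_mul])
      map_mul' := fun r s => LinearMap.ext fun n => Subtype.ext (by
        change f (r * s) * n.1 = f r * (f s * n.1)
        rw [map_mul, mul_assoc]) }

/-- The subspace `R M` of `M`, spanned by all products `r m`. -/
def prodSpan (M : LeftMod k R) : Submodule k M :=
  Submodule.span k {n | ∃ (r : R) (m : M), M.act r m = n}

/-- A module is unital if `R M = M`. -/
def IsUnital (M : LeftMod k R) : Prop := M.prodSpan = ⊤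

/-- The module `R M`, the unital part of `M`. -/
def unitalPart (M : LeftMod k R) : LeftMod k R :=
  M.sub M.prodSpan fun r n _ => Submodule.subset_span ⟨r, n, rfl⟩

/-- A module is finitely generated if some finite subset is contained in no proper submodule. -/
def IsFG (M : LeftMod k R) : Prop :=
  ∃ s : Finset M, ∀ N : Submodule k M, (∀ r : R, ∀ n ∈ N, M.act r n ∈ N) →
    (∀ m ∈ s, m ∈ N) → N = ⊤

/-- Projectivity in the category of unital modules: homomorphisms out of `M` lift along
surjective homomorphisms of unital modules. -/
def IsProjective (M : LeftMod k R) : Prop :=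
  ∀ (P Q : LeftMod k R), P.IsUnital → Q.IsUnital →
    ∀ g ∈ homs P Q, Function.Surjective g → ∀ f ∈ homs M Q, ∃ f' ∈ homs M P, g ∘ₗ f' = f

end LeftMod

namespace PathAlgebra

variable (k : Type u) [Field k]

section LeftIdeals

variable {C : Type u} [Category.{u} C]

/-- The left module `R 1_x` over the path algebra `R`. -/
def leftIdeal (x : C) : LeftMod k (PathAlgebra k C) :=
  LeftMod.ofSubspace (NonUnitalAlgHom.id k (PathAlgebra k C))
    (LinearMap.range (LinearMap.mulRight k (idem k x)))
    (by
      rintro r _ ⟨a, rfl⟩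
      exact ⟨r * a, mul_assoc r a (idem k x)⟩)

variable {k} in
/-- An element of `R 1_x`, as an element of `R`. -/
def leftIdeal.val {x : C} (b : leftIdeal k x) : PathAlgebra k C := b.1

/-- Right multiplication `R 1_y → R 1_x` by an arrow `f : x ⟶ y`. -/
def leftIdeal.mulArrow {x y : C} (f : x ⟶ y) (b : leftIdeal k y) : leftIdeal k x :=
  ⟨leftIdeal.val b * of k f, leftIdeal.val b * of k f, by
    change leftIdeal.val b * of k f * of k (𝟙 x) = leftIdeal.val b * of k f
    rw [mul_assoc, of_mul_of, Category.id_comp]⟩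

end LeftIdeals

section Extension

variable {H G : Type u} [Category.{u} H] [Category.{u} G] (φ : H ⥤ G)
  (hφ : Function.Injective φ.obj)

/-- The subspace `A B` of `B`, spanned by all products `a b`; here `A` and `B` are the path
algebras of `H` and `G`, and `A` acts on `B` through the homomorphism induced by `φ`. -/
def ABSpace : Submodule k (PathAlgebra k G) :=
  Submodule.span k {m | ∃ (a : PathAlgebra k H) (b : PathAlgebra k G), map k φ hφ a * b = m}

/-- The subspace `A B 1_x` of `B`, spanned by all products `a b 1_x`. -/
def ABIdemSpace (x : G) : Submodule k (PathAlgebra k G) :=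
  Submodule.span k {m | ∃ (a : PathAlgebra k H) (b : PathAlgebra k G),
    map k φ hφ a * b * idem k x = m}

/-- The left `A`-module `A B`. -/
def AB : LeftMod k (PathAlgebra k H) :=
  LeftMod.ofSubspace (map k φ hφ) (ABSpace k φ hφ) fun r n _ => Submodule.subset_span ⟨r, n, rfl⟩

/-- The left `A`-module `A B 1_x`. -/
def ABIdem (x : G) : LeftMod k (PathAlgebra k H) :=
  LeftMod.ofSubspace (map k φ hφ) (ABIdemSpace k φ hφ x) (by
    intro r n hn
    refine (Submodule.span_le (p := (ABIdemSpace k φ hφ x).comap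
      (LinearMap.mulLeft k (map k φ hφ r)))).2 ?_ hn
    rintro _ ⟨a, b, rfl⟩
    refine Submodule.subset_span ⟨r * a, b, ?_⟩
    simp [mul_assoc])

/-- Right multiplication by `b : B` on `A B`. -/
def ABSpace.mulRight (b : PathAlgebra k G) : ABSpace k φ hφ →ₗ[k] ABSpace k φ hφ :=
  (LinearMap.mulRight k b).restrict (by
    intro n hn
    refine (Submodule.span_le (p := (ABSpace k φ hφ).comap (LinearMap.mulRight k b))).2 ?_ hn
    rintro _ ⟨a, m, rfl⟩
    exact Submodule.subset_span ⟨a, m * b, (mul_assoc _ _ _).symm⟩)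

/-- The right action of `b : B` on the `(A, B)`-bimodule `A B`. -/
def AB.mulRight (b : PathAlgebra k G) : AB k φ hφ →ₗ[k] AB k φ hφ := ABSpace.mulRight k φ hφ b

variable {k φ hφ} in
/-- An element of `A B`, as an element of `B`. -/
def AB.val (m : AB k φ hφ) : PathAlgebra k G := m.1

/-- The left `B`-module `Hom_A(AB, A 1_u)`, with `(b f)(m) = f (m b)`. -/
def homAB (u : H) : LeftMod k (PathAlgebra k G) where
  carrier := LeftMod.homs (AB k φ hφ) (leftIdeal k u)
  act :=
    { toFun := fun b =>
        { toFun := fun f => ⟨f.1 ∘ₗ AB.mulRight k φ hφ b, by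
            intro a m
            have hm : AB.mulRight k φ hφ b ((AB k φ hφ).act a m) =
                (AB k φ hφ).act a (AB.mulRight k φ hφ b m) :=
              Subtype.ext (mul_assoc (map k φ hφ a) (AB.val m) b)
            have hf := f.2 a (AB.mulRight k φ hφ b m)
            rw [LinearMap.comp_apply, LinearMap.comp_apply, hm, hf]⟩
          map_add' := fun f g => rfl
          map_smul' := fun c f => rfl }
      map_smul' := fun c b => by
        refine LinearMap.ext fun f => Subtype.ext (LinearMap.ext fun m => ?_)
        have h : AB.mulRight k φ hφ (c • b) m = c • AB.mulRight k φ hφ b m :=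
          Subtype.ext (mul_smul_comm c (AB.val m) b)
        exact (congrArg f.1 h).trans (map_smul f.1 c _)
      map_zero' := by
        refine LinearMap.ext fun f => Subtype.ext (LinearMap.ext fun m => ?_)
        have h : AB.mulRight k φ hφ 0 m = 0 :=
          Subtype.ext (mul_zero (AB.val m))
        exact (congrArg f.1 h).trans (map_zero f.1)
      map_add' := fun b b' => by
        refine LinearMap.ext fun f => Subtype.ext (LinearMap.ext fun m => ?_)
        have h : AB.mulRight k φ hφ (b + b') m =
            AB.mulRight k φ hφ b m + AB.mulRight k φ hφ b' m :=
          Subtype.ext (mul_add (AB.val m) b b')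
        exact (congrArg f.1 h).trans (map_add f.1 _ _)
      map_mul' := fun b b' => by
        refine LinearMap.ext fun f => Subtype.ext (LinearMap.ext fun m => ?_)
        have h : AB.mulRight k φ hφ (b * b') m =
            AB.mulRight k φ hφ b' (AB.mulRight k φ hφ b m) :=
          Subtype.ext (mul_assoc (AB.val m) b b').symm
        exact congrArg f.1 h }

/-- The unital left `B`-module `B Hom_A(AB, A 1_u)`. -/
def BHomAB (u : H) : LeftMod k (PathAlgebra k G) := (homAB k φ hφ u).unitalPart

variable {k φ hφ} in
/-- The value at `m : AB` of an element of `B Hom_A(AB, A 1_u)`. -/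
def BHomAB.eval {u : H} (f : BHomAB k φ hφ u) (m : AB k φ hφ) : leftIdeal k u := f.1.1 m

/-- For every object `x` of `G` the unital left `A`-module `A B 1_x` is finitely generated and
projective, and there are isomorphisms `B 1_{φ u} ≅ B Hom_A(AB, A 1_u)` of left `B`-modules,
natural in the object `u` of `H`: an arrow `h : u' ⟶ u` acts on the left-hand sides through right
multiplication by `φ h`, and on the right-hand sides through right multiplication
`A 1_u → A 1_{u'}` by `h`. -/
def BimoduleCondition : Prop :=
  (∀ x : G, (ABIdem k φ hφ x).IsUnital ∧ (ABIdem k φ hφ x).IsFG ∧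
    (ABIdem k φ hφ x).IsProjective) ∧
  ∃ Φ : ∀ u : H, leftIdeal k (φ.obj u) ≃ₗ[k] BHomAB k φ hφ u,
    (∀ (u : H), (Φ u).toLinearMap ∈ LeftMod.homs (leftIdeal k (φ.obj u)) (BHomAB k φ hφ u)) ∧
    ∀ (u u' : H) (h : u' ⟶ u) (b : leftIdeal k (φ.obj u)) (m : AB k φ hφ),
      BHomAB.eval (Φ u' (leftIdeal.mulArrow k (φ.map h) b)) m =
        leftIdeal.mulArrow k h (BHomAB.eval (Φ u b) m)

end Extension

end PathAlgebra

/-! ## Induction and co-induction of linear representations -/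

section Representations

variable (k : Type u) [Field k]

/-- The category of `k`-linear representations of a small category. -/
abbrev LinRep (C : Type u) [Category.{u} C] := C ⥤ ModuleCat.{u} k

variable {k} {H G : Type u} [Category.{u} H] [Category.{u} G] (φ : H ⥤ G)

/-- The vector space of natural transformations from the set-valued functor
`u ↦ (x ⟶ φ u)` to the underlying set-valued functor of a representation `W`. -/
def indFibre (W : LinRep k H) (x : G) : Submodule k (∀ u : H, (x ⟶ φ.obj u) → W.obj u) where
  carrier := {α | ∀ (u v : H) (h : u ⟶ v) (p : x ⟶ φ.obj u),
    α v (p ≫ φ.map h) = (W.map h).hom (α u p)}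
  add_mem' := fun ha hb u v h p => by simp [ha u v h p, hb u v h p]
  zero_mem' := fun u v h p => by simp
  smul_mem' := fun c a ha u v h p => by simp [ha u v h p]

/-- Precomposition with `g : x ⟶ y`. -/
def indFibreMap (W : LinRep k H) {x y : G} (g : x ⟶ y) :
    indFibre φ W x →ₗ[k] indFibre φ W y where
  toFun α := ⟨fun u p => α.1 u (g ≫ p), fun u v h p => by
    rw [← α.2 u v h (g ≫ p), Category.assoc]⟩
  map_add' _ _ := rfl
  map_smul' _ _ := rfl

/-- Postcomposition with a morphism of representations. -/
def indFibreMap' {W W' : LinRep k H} (f : W ⟶ W') (x : G) :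
    indFibre φ W x →ₗ[k] indFibre φ W' x where
  toFun α := ⟨fun u p => (f.app u).hom (α.1 u p), fun u v h p => by
    refine (congrArg (f.app v).hom (α.2 u v h p)).trans ?_
    exact congrArg (fun q => q.hom (α.1 u p)) (f.naturality h)⟩
  map_add' _ _ := by ext; simp
  map_smul' _ _ := by ext; simp

/-- The induction functor: `W ↦ (x ↦ Nat((x ⟶ φ -), W))`. -/
def inductionFunctor : LinRep k H ⥤ LinRep k G where
  obj W :=
    { obj := fun x => ModuleCat.of k (indFibre φ W x)
      map := fun g => ModuleCat.ofHom (indFibreMap φ W g)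
      map_id := fun x => by
        refine ModuleCat.hom_ext (LinearMap.ext fun α => ?_)
        refine Subtype.ext (funext fun u => funext fun p => ?_)
        exact congrArg (α.1 u) (Category.id_comp p)
      map_comp := fun g g' => by
        refine ModuleCat.hom_ext (LinearMap.ext fun α => ?_)
        refine Subtype.ext (funext fun u => funext fun p => ?_)
        exact congrArg (α.1 u) (Category.assoc g g' p) }
  map f :=
    { app := fun x => ModuleCat.ofHom (indFibreMap' φ f x)
      naturality := fun x y g => rfl }
  map_id W := rfl
  map_comp f g := rfl

/-- The co-induction functor: `W ↦ (x ↦ colim W_u)`, the colimit being taken over the category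
of pairs `(u, a : φ u ⟶ x)`, whose arrows `(u, a) ⟶ (u', a')` are the arrows `h : u ⟶ u'`
with `a = a' ∘ φ h`; an arrow `g` of `G` acts through `(u, a) ↦ (u, g ∘ a)`. -/
def coinductionFunctor : LinRep k H ⥤ LinRep k G where
  obj W := φ.pointwiseLeftKanExtension W
  map f :=
    { app := fun x => colimMap (Functor.whiskerLeft (CostructuredArrow.proj φ x) f)
      naturality := fun x y g => by
        refine colimit.hom_ext fun j => ?_
        simp only [Functor.pointwiseLeftKanExtension, colimit.ι_desc_assoc, ι_colimMap_assoc,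
          colimit.ι_desc]
        exact ι_colimMap (Functor.whiskerLeft (CostructuredArrow.proj φ y) f)
          ((CostructuredArrow.map g).obj j) }
  map_id W := by
    ext x : 2
    refine colimit.hom_ext fun j => ?_
    simp [Functor.pointwiseLeftKanExtension]
  map_comp f g := by
    ext x : 2
    refine colimit.hom_ext fun j => ?_
    simp [Functor.pointwiseLeftKanExtension]

variable (k) in
/-- A morphism of groupoids is Frobenius if its induction and co-induction functors are naturally
isomorphic. -/
def IsFrobeniusMorphism : Prop :=
  Nonempty ((inductionFunctor φ : LinRep k H ⥤ LinRep k G) ≅ coinductionFunctor φ)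

variable (k) in
/-- There are a natural transformation `E` from `(φ u ⟶ φ v)` to `(u ⟶ v) →₀ k`, of functors on
`Hᵒᵖ × H`, and for every object `x` of `G` a finite family `((u i, b i), c i)` with arrows
`b i : φ (u i) ⟶ x` and with `c i` in the span of the arrows `x ⟶ φ (u i)`, such that
`∑ E(β b_i) c_i = β` and `β' = ∑ b_i E(c_i β')` for all arrows `β : x ⟶ φ v` and
`β' : φ v ⟶ x`. -/
def HasDualBases : Prop :=
  ∃ E : ∀ u v : H, (φ.obj u ⟶ φ.obj v) → ((u ⟶ v) →₀ k),
    (∀ (u v u' v' : H) (h : u' ⟶ u) (h' : v ⟶ v') (p : φ.obj u ⟶ φ.obj v),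
      E u' v' (φ.map h ≫ p ≫ φ.map h') =
        Finsupp.mapDomain (fun a : u ⟶ v => h ≫ a ≫ h') (E u v p)) ∧
    ∀ x : G, ∃ (N : ℕ) (u : Fin N → H) (b : ∀ i, φ.obj (u i) ⟶ x)
      (c : ∀ i, (x ⟶ φ.obj (u i)) →₀ k),
      ∀ (v : H) (β : x ⟶ φ.obj v) (β' : φ.obj v ⟶ x),
        (∑ i, linComp k (linMap k φ (E (u i) v (b i ≫ β))) (c i) = Finsupp.single β 1) ∧
        (Finsupp.single β' 1 = ∑ i, linComp k (Finsupp.single (b i) 1)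
          (linMap k φ (Finsupp.linearCombination k (E v (u i))
            (linComp k (c i) (Finsupp.single β' 1)))))

end Representations

end

/-!
The three conditions are compared through dual bases; `A` and `B` are the path algebras of `H` and
`G`, acting on representations and on each other through `φ`.

A morphism from co-induction to induction is the same thing as a binatural family
`E : (φ u ⟶ φ v) → kH(u, v)`: naturality in the representation reduces it to free representations
`kH(u, -)` (`freeRep`) and naturality in `G` to the values at identities, and it is recovered as
`b ⊗ w ↦ (β ↦ E(β b) w)` (`coindToIndComponent_coindMk`, `IsBinatural.coindToInd`). Dual bases
`b i`, `c i` make it invertible, with inverse `α ↦ ∑ b i ⊗ α (c i)`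
(`HasDualBases.isFrobeniusMorphism`). If it is invertible, the preimage of the universal element
`β ↦ β` of the representation induced from `u ↦ kG(x, φ u)` is a finite sum `∑ b i ⊗ c i`, and
this is a pair of dual bases at `x` (`IsFrobeniusMorphism.hasDualBases`).

On the side of algebras the family `E` becomes a homomorphism of `A`-bimodules `B → A`, extended
by zero (`extendKernel`), and dual bases become elements of `B` (`IsDualBasis`). The identity
`∑ E(m b i) c i = m` says that the `c i` and the functionals `m ↦ E(m b i)` form a dual basis of
the `A`-module `A B 1_x`, which is therefore finitely generated and projective; and
`b ↦ (m ↦ E(m b))` is an isomorphism `B 1_u ≅ B Hom_A(AB, A 1_u)` with inverse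
`f ↦ ∑ b i f(c i)` (`bimoduleCondition_of_isDualBasis`). Conversely, natural isomorphisms `Φ` have
this form for `E(p) = Φ(p)(1)` (`evalIso_eq`), the coordinate functionals of the finitely generated
projective module `A B 1_x` are thus represented by elements `b i` of `B`, and the second identity
follows from the first by injectivity of `Φ` (`exists_isDualBasis_of_iso`).
-/

noncomputable section

/-! ### Linearised hom-sets -/

section Linearised

variable {k : Type u} [Field k] {C D : Type u} [Category.{u} C] [Category.{u} D]

theorem linComp_single_single {x y z : C} (p : y ⟶ z) (q : x ⟶ y) (r s : k) :
    linComp k (Finsupp.single p r) (Finsupp.single q s) = Finsupp.single (q ≫ p) (r * s) := by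
  simp [linComp]

theorem linMap_single (F : C ⥤ D) {x y : C} (p : x ⟶ y) (r : k) :
    linMap k F (Finsupp.single p r) = Finsupp.single (F.map p) r := by
  simp [linMap]

/-- The action `kC(u, v) × W u → W v` of linear combinations of arrows on a representation. -/
def linAct (W : LinRep k C) {u v : C} :
    ((u ⟶ v) →₀ k) →ₗ[k] W.obj u →ₗ[k] W.obj v :=
  Finsupp.linearCombination k fun h => (W.map h).hom

theorem linAct_single (W : LinRep k C) {u v : C} (h : u ⟶ v) (r : k) (w : W.obj u) :
    linAct W (Finsupp.single h r) w = r • (W.map h).hom w := by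
  simp [linAct]

theorem linAct_id (W : LinRep k C) {u : C} (w : W.obj u) :
    linAct W (Finsupp.single (𝟙 u) 1) w = w := by
  simp [linAct]

theorem linAct_mapDomain_left (W : LinRep k C) {u u' v : C} (h : u' ⟶ u) (e : (u ⟶ v) →₀ k)
    (w : W.obj u') :
    linAct W (Finsupp.mapDomain (fun a => h ≫ a) e) w = linAct W e ((W.map h).hom w) := by
  induction e using Finsupp.induction_linear with
  | zero => simp
  | add e f he hf => simp [Finsupp.mapDomain_add, he, hf]
  | single a r => simp [linAct_single]

theorem linAct_mapDomain_right (W : LinRep k C) {u v v' : C} (h : v ⟶ v') (e : (u ⟶ v) →₀ k)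
    (w : W.obj u) :
    linAct W (Finsupp.mapDomain (fun a => a ≫ h) e) w = (W.map h).hom (linAct W e w) := by
  induction e using Finsupp.induction_linear with
  | zero => simp
  | add e f he hf => simp [Finsupp.mapDomain_add, he, hf]
  | single a r => simp [linAct_single]

theorem linAct_naturality {W W' : LinRep k C} (f : W ⟶ W') {u v : C} (e : (u ⟶ v) →₀ k)
    (w : W.obj u) : (f.app v).hom (linAct W e w) = linAct W' e ((f.app u).hom w) := by
  induction e using Finsupp.induction_linear with
  | zero => simp
  | add e f he hf => simp [he, hf]
  | single a r =>
    rw [linAct_single, linAct_single, map_smul]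
    exact congrArg (r • ·) (congrArg (fun q => q.hom w) (f.naturality a))

variable (k) in
/-- The free representation `v ↦ kC(x, v)` on one generator at `x`. -/
abbrev freeRep (x : C) : LinRep k C where
  obj v := ModuleCat.of k ((x ⟶ v) →₀ k)
  map h := ModuleCat.ofHom (Finsupp.lmapDomain k k fun a => a ≫ h)
  map_id v := by
    refine ModuleCat.hom_ext (LinearMap.ext fun e => ?_)
    simp only [Category.comp_id]
    exact Finsupp.mapDomain_id (v := e)
  map_comp h h' := by
    refine ModuleCat.hom_ext (LinearMap.ext fun e => ?_)
    simp [← Finsupp.mapDomain_comp, Function.comp_def]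

theorem freeRep_map (x : C) {v v' : C} (h : v ⟶ v') (e : (x ⟶ v) →₀ k) :
    ((freeRep k x).map h).hom e = Finsupp.mapDomain (fun a => a ≫ h) e := rfl

/-- The morphism out of the free representation that sends the generator to `w`. -/
def freeRepHom (W : LinRep k C) {x : C} (w : W.obj x) : freeRep k x ⟶ W where
  app v := ModuleCat.ofHom ((linAct W).flip w)
  naturality v v' h := by
    refine ModuleCat.hom_ext (LinearMap.ext fun e => ?_)
    exact linAct_mapDomain_right W h e w

theorem freeRepHom_app (W : LinRep k C) {x v : C} (w : W.obj x) (e : (x ⟶ v) →₀ k) :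
    ((freeRepHom W w).app v).hom e = linAct W e w := rfl

/-- The action on a pulled back free representation is composition. -/
theorem linAct_comp_freeRep (F : C ⥤ D) (x : D) {u v : C} (e : (u ⟶ v) →₀ k)
    (c : (x ⟶ F.obj u) →₀ k) :
    linAct (F ⋙ freeRep k x) e c = linComp k (linMap k F e) c := by
  induction e using Finsupp.induction_linear with
  | zero => simp
  | add e f he hf => simp only [map_add, LinearMap.add_apply, he, hf]
  | single a r =>
    rw [linAct_single, linMap_single]
    change r • Finsupp.mapDomain _ c = _
    induction c using Finsupp.induction_linear with
    | zero => simp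
    | add c d hc hd => simp only [Finsupp.mapDomain_add, smul_add, map_add, hc, hd]
    | single c s => simp [linComp_single_single]

theorem linAct_freeRep_single {u u' v : C} (h : u' ⟶ u) (e : (u ⟶ v) →₀ k) :
    linAct (freeRep k u') e (Finsupp.single h 1) = Finsupp.mapDomain (fun a => h ≫ a) e := by
  induction e using Finsupp.induction_linear with
  | zero => simp
  | add e f he hf => simp only [map_add, LinearMap.add_apply, he, hf, Finsupp.mapDomain_add]
  | single a r =>
    rw [linAct_single, freeRep_map, Finsupp.mapDomain_single, Finsupp.mapDomain_single,
      Finsupp.smul_single, smul_eq_mul, mul_one]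

end Linearised

/-! ### Elements of induced and co-induced representations -/

section Kan

variable {k : Type u} [Field k] {H G : Type u} [Category.{u} H] [Category.{u} G] {φ : H ⥤ G}

/-- The class in the co-induced representation at `x` of a vector `w` at `u`, placed at the index
`b : φ u ⟶ x` of the colimit. -/
def coindMk (φ : H ⥤ G) (W : LinRep k H) {u : H} {x : G} (b : φ.obj u ⟶ x) :
    W.obj u →ₗ[k] ((coinductionFunctor φ).obj W).obj x :=
  (colimit.ι (CostructuredArrow.proj φ x ⋙ W) (CostructuredArrow.mk b)).hom

theorem coindMk_map (W : LinRep k H) {u v : H} {x : G} (h : u ⟶ v) (b : φ.obj v ⟶ x)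
    (w : W.obj u) : coindMk φ W b ((W.map h).hom w) = coindMk φ W (φ.map h ≫ b) w :=
  congrArg (fun q => q.hom w) (colimit.w (CostructuredArrow.proj φ x ⋙ W)
    (CostructuredArrow.homMk h : CostructuredArrow.mk (φ.map h ≫ b) ⟶ CostructuredArrow.mk b))

theorem coind_obj_map (W : LinRep k H) {u : H} {x y : G} (b : φ.obj u ⟶ x) (g : x ⟶ y)
    (w : W.obj u) :
    (((coinductionFunctor φ).obj W).map g).hom (coindMk φ W b w) = coindMk φ W (b ≫ g) w := by
  refine congrArg (fun q => q.hom w) (?_ : colimit.ι (CostructuredArrow.proj φ x ⋙ W)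
    (CostructuredArrow.mk b) ≫ (φ.pointwiseLeftKanExtension W).map g = _)
  simp only [Functor.pointwiseLeftKanExtension, colimit.ι_desc]
  rfl

theorem coind_map_app {W W' : LinRep k H} (f : W ⟶ W') {u : H} {x : G} (b : φ.obj u ⟶ x)
    (w : W.obj u) :
    (((coinductionFunctor φ).map f).app x).hom (coindMk φ W b w) =
      coindMk φ W' b ((f.app u).hom w) :=
  congrArg (fun q => q.hom w)
    (ι_colimMap (Functor.whiskerLeft (CostructuredArrow.proj φ x) f) (CostructuredArrow.mk b))

theorem coind_linearMap_ext {W : LinRep k H} {x : G} {M : Type u} [AddCommGroup M] [Module k M]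
    {f g : ((coinductionFunctor φ).obj W).obj x →ₗ[k] M}
    (h : ∀ (u : H) (b : φ.obj u ⟶ x) (w : W.obj u),
      f (coindMk φ W b w) = g (coindMk φ W b w)) : f = g := by
  have : (ModuleCat.ofHom f : colimit (CostructuredArrow.proj φ x ⋙ W) ⟶ ModuleCat.of k M) =
      ModuleCat.ofHom g := by
    refine colimit.hom_ext fun j => ModuleCat.hom_ext (LinearMap.ext fun w => ?_)
    obtain ⟨u, ⟨⟨⟩⟩, b⟩ := j
    exact h u b w
  exact congrArg ModuleCat.Hom.hom this

theorem coind_span (W : LinRep k H) (x : G) :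
    Submodule.span k {z | ∃ (u : H) (b : φ.obj u ⟶ x) (w : W.obj u), coindMk φ W b w = z} = ⊤ := by
  rw [← Submodule.ker_mkQ (Submodule.span k _), LinearMap.ker_eq_top]
  refine coind_linearMap_ext (φ := φ) fun u b w => ?_
  rw [LinearMap.zero_apply, Submodule.mkQ_apply, Submodule.Quotient.mk_eq_zero]
  exact Submodule.subset_span ⟨u, b, w, rfl⟩

/-- Every element of a co-induced representation is a finite sum of classes of vectors. -/
theorem exists_sum_coindMk {W : LinRep k H} {x : G} (z : ((coinductionFunctor φ).obj W).obj x) :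
    ∃ (N : ℕ) (u : Fin N → H) (b : ∀ i, φ.obj (u i) ⟶ x) (w : ∀ i, W.obj (u i)),
      z = ∑ i, coindMk φ W (b i) (w i) := by
  have hz : z ∈ Submodule.span k
      {z | ∃ (u : H) (b : φ.obj u ⟶ x) (w : W.obj u), coindMk φ W b w = z} := by
    rw [coind_span]; trivial
  obtain ⟨N, r, g, rfl⟩ := Submodule.mem_span_set'.1 hz
  choose u b w h using fun i => (g i).2
  exact ⟨N, u, b, fun i => r i • w i, by simp [h]⟩

theorem coindMk_linAct (W : LinRep k H) {u v : H} {x : G} (b : φ.obj v ⟶ x)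
    (e : (u ⟶ v) →₀ k) (w : W.obj u) :
    coindMk φ W b (linAct W e w) =
      Finsupp.linearCombination k (fun p : φ.obj u ⟶ x => coindMk φ W p w)
        (linComp k (Finsupp.single b 1) (linMap k φ e)) := by
  induction e using Finsupp.induction_linear with
  | zero => simp
  | add e f he hf => simp only [map_add, LinearMap.add_apply, he, hf]
  | single a r =>
    rw [linAct_single, map_smul, coindMk_map, linMap_single, linComp_single_single]
    simp

/-- The linear map out of a co-induced representation defined by a compatible family. -/
def coindDesc {W : LinRep k H} {x : G} {M : Type u} [AddCommGroup M] [Module k M]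
    (f : ∀ u : H, (φ.obj u ⟶ x) → W.obj u →ₗ[k] M)
    (hf : ∀ (u v : H) (h : u ⟶ v) (b : φ.obj v ⟶ x) (w : W.obj u),
      f v b ((W.map h).hom w) = f u (φ.map h ≫ b) w) :
    ((coinductionFunctor φ).obj W).obj x →ₗ[k] M :=
  (colimit.desc (CostructuredArrow.proj φ x ⋙ W)
    { pt := ModuleCat.of k M
      ι :=
        { app j := ModuleCat.ofHom (f j.left j.hom)
          naturality i j g := ModuleCat.hom_ext (LinearMap.ext fun w =>
            (hf _ _ g.left j.hom w).trans (by rw [CostructuredArrow.w]; rfl)) } }).hom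

theorem coindDesc_coindMk {W : LinRep k H} {x : G} {M : Type u} [AddCommGroup M] [Module k M]
    (f : ∀ u : H, (φ.obj u ⟶ x) → W.obj u →ₗ[k] M)
    (hf : ∀ (u v : H) (h : u ⟶ v) (b : φ.obj v ⟶ x) (w : W.obj u),
      f v b ((W.map h).hom w) = f u (φ.map h ≫ b) w) {u : H} (b : φ.obj u ⟶ x) (w : W.obj u) :
    coindDesc f hf (coindMk φ W b w) = f u b w := by
  refine congrArg (fun q => q.hom w) (?_ : colimit.ι (CostructuredArrow.proj φ x ⋙ W)
    (CostructuredArrow.mk b) ≫ ModuleCat.ofHom (coindDesc f hf) = ModuleCat.ofHom (f u b))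
  exact colimit.ι_desc (F := CostructuredArrow.proj φ x ⋙ W) _ (CostructuredArrow.mk b)

/-- The value of an element of the induced representation at linear combinations of arrows. -/
def indEval (W : LinRep k H) {x : G} {v : H} :
    ((x ⟶ φ.obj v) →₀ k) →ₗ[k] indFibre φ W x →ₗ[k] W.obj v :=
  Finsupp.linearCombination k fun p =>
    LinearMap.proj p ∘ₗ LinearMap.proj v ∘ₗ (indFibre φ W x).subtype

theorem indEval_single {W : LinRep k H} {x : G} (α : indFibre φ W x) {v : H} (p : x ⟶ φ.obj v)
    (r : k) : indEval W (Finsupp.single p r) α = r • α.1 v p := by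
  simp [indEval]

theorem indEval_linComp {W : LinRep k H} {x : G} (α : indFibre φ W x) {u v : H}
    (e : (u ⟶ v) →₀ k) (c : (x ⟶ φ.obj u) →₀ k) :
    indEval W (linComp k (linMap k φ e) c) α = linAct W e (indEval W c α) := by
  induction e using Finsupp.induction_linear with
  | zero => simp
  | add e f he hf => simp only [map_add, LinearMap.add_apply, he, hf]
  | single a r =>
    induction c using Finsupp.induction_linear with
    | zero => simp
    | add c d hc hd => simp only [map_add, LinearMap.add_apply, hc, hd]
    | single c s =>
      rw [linMap_single, linComp_single_single, linAct_single, indEval_single, indEval_single,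
        α.2, map_smul, smul_smul]

end Kan

/-! ### Frobenius morphisms and dual bases -/

section FrobeniusDualBases

variable {k : Type u} [Field k] {H G : Type u} [Category.{u} H] [Category.{u} G] {φ : H ⥤ G}

/-- Naturality of a family `E : (φ u ⟶ φ v) → kH(u, v)` in both variables. -/
def IsBinatural (E : ∀ u v : H, (φ.obj u ⟶ φ.obj v) → ((u ⟶ v) →₀ k)) : Prop :=
  ∀ (u v u' v' : H) (h : u' ⟶ u) (h' : v ⟶ v') (p : φ.obj u ⟶ φ.obj v),
    E u' v' (φ.map h ≫ p ≫ φ.map h') =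
      Finsupp.mapDomain (fun a : u ⟶ v => h ≫ a ≫ h') (E u v p)

namespace IsBinatural

variable {E : ∀ u v : H, (φ.obj u ⟶ φ.obj v) → ((u ⟶ v) →₀ k)}

theorem map_comp_left (hE : IsBinatural E) {u v u' : H} (h : u' ⟶ u) (p : φ.obj u ⟶ φ.obj v) :
    E u' v (φ.map h ≫ p) = Finsupp.mapDomain (fun a : u ⟶ v => h ≫ a) (E u v p) := by
  simpa using hE u v u' v h (𝟙 v) p

theorem map_comp_right (hE : IsBinatural E) {u v v' : H} (h : v ⟶ v') (p : φ.obj u ⟶ φ.obj v) :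
    E u v' (p ≫ φ.map h) = Finsupp.mapDomain (fun a : u ⟶ v => a ≫ h) (E u v p) := by
  simpa using hE u v u v' (𝟙 u) h p

/-- The map from the co-induced to the induced representation given by
`b ⊗ w ↦ (β ↦ E(β b) w)`. -/
def coindToIndFibre (hE : IsBinatural E) (W : LinRep k H) (x : G) :
    ((coinductionFunctor φ).obj W).obj x →ₗ[k] indFibre φ W x :=
  coindDesc
    (fun u b =>
      { toFun w := ⟨fun v β => linAct W (E u v (b ≫ β)) w, fun v v' h β => by
          beta_reduce
          rw [← Category.assoc, hE.map_comp_right, linAct_mapDomain_right]⟩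
        map_add' w w' := Subtype.ext (funext fun v => funext fun β => map_add _ w w')
        map_smul' r w := Subtype.ext (funext fun v => funext fun β => map_smul _ r w) })
    fun u u' h b w => Subtype.ext (funext fun v => funext fun β => by
      change linAct W (E u' v (b ≫ β)) ((W.map h).hom w) =
        linAct W (E u v ((φ.map h ≫ b) ≫ β)) w
      rw [← linAct_mapDomain_left, ← hE.map_comp_left, Category.assoc])

theorem coindToIndFibre_coindMk (hE : IsBinatural E) (W : LinRep k H) {u v : H} {x : G}
    (b : φ.obj u ⟶ x) (w : W.obj u) (β : x ⟶ φ.obj v) :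
    (hE.coindToIndFibre W x (coindMk φ W b w)).1 v β = linAct W (E u v (b ≫ β)) w :=
  congrArg (fun q : indFibre φ W x => q.1 v β) (coindDesc_coindMk _ _ b w)

/-- The maps `coindToIndFibre` are natural. -/
def coindToInd (hE : IsBinatural E) :
    (coinductionFunctor φ : LinRep k H ⥤ LinRep k G) ⟶ inductionFunctor φ where
  app W :=
    { app x := ModuleCat.ofHom (hE.coindToIndFibre W x)
      naturality x y g := by
        refine ModuleCat.hom_ext (coind_linearMap_ext fun u b w => ?_)
        refine Subtype.ext (funext fun v => funext fun β => ?_)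
        change (hE.coindToIndFibre W y
          ((((coinductionFunctor φ).obj W).map g).hom (coindMk φ W b w))).1 v β =
          (hE.coindToIndFibre W x (coindMk φ W b w)).1 v (g ≫ β)
        rw [coind_obj_map, coindToIndFibre_coindMk, coindToIndFibre_coindMk, Category.assoc] }
  naturality W W' f := by
    ext x : 2
    refine ModuleCat.hom_ext (coind_linearMap_ext fun u b w => ?_)
    refine Subtype.ext (funext fun v => funext fun β => ?_)
    change (hE.coindToIndFibre W' x
      ((((coinductionFunctor φ).map f).app x).hom (coindMk φ W b w))).1 v β =
      (f.app v).hom ((hE.coindToIndFibre W x (coindMk φ W b w)).1 v β)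
    rw [coind_map_app, coindToIndFibre_coindMk, coindToIndFibre_coindMk, linAct_naturality]

end IsBinatural

end FrobeniusDualBases

section FrobeniusDualBases

variable {k : Type u} [Field k] {H G : Type u} [Category.{u} H] [Groupoid.{u} G] {φ : H ⥤ G}

/-- A pair of dual bases `b i`, `c i` gives the inverse `α ↦ ∑ b i ⊗ α (c i)` of `coindToInd`. -/
theorem HasDualBases.isFrobeniusMorphism (h : HasDualBases k φ) : IsFrobeniusMorphism k φ := by
  obtain ⟨E, hE, hdual⟩ := h
  have hE : IsBinatural E := hE
  have hbij (W : LinRep k H) (x : G) : Function.Bijective (hE.coindToIndFibre W x) := by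
    obtain ⟨N, u, b, c, h⟩ := hdual x
    let inv : indFibre φ W x →ₗ[k] ((coinductionFunctor φ).obj W).obj x :=
      ∑ i, coindMk φ W (b i) ∘ₗ indEval W (c i)
    have inv_apply (α) : inv α = ∑ i, coindMk φ W (b i) (indEval W (c i) α) := by
      simp [inv]
    refine Function.bijective_iff_has_inverse.2 ⟨inv, fun z => ?_, fun α => ?_⟩
    · suffices inv ∘ₗ hE.coindToIndFibre W x = LinearMap.id from congrArg (fun q => q z) this
      refine coind_linearMap_ext fun v b' w => ?_
      have hev (v' : H) (e : (x ⟶ φ.obj v') →₀ k) :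
          indEval W e (hE.coindToIndFibre W x (coindMk φ W b' w)) =
            linAct W (Finsupp.linearCombination k (E v v')
              (linComp k e (Finsupp.single b' 1))) w := by
        induction e using Finsupp.induction_linear with
        | zero => simp
        | add e f he hf => simp only [map_add, LinearMap.add_apply, he, hf]
        | single a r =>
          simp [indEval_single, hE.coindToIndFibre_coindMk, linComp_single_single]
      rw [LinearMap.comp_apply, inv_apply, LinearMap.id_apply]
      simp only [hev, coindMk_linAct]
      -- the second identity comes paired with an arrow in the other direction; the inverse serves
      rw [← map_sum, ← (h v (Groupoid.inv b') b').2]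
      simp
    · refine Subtype.ext (funext fun v => funext fun β => ?_)
      have hmk (i) : (hE.coindToIndFibre W x (coindMk φ W (b i) (indEval W (c i) α))).1 v β =
          indEval W (linComp k (linMap k φ (E (u i) v (b i ≫ β))) (c i)) α := by
        rw [hE.coindToIndFibre_coindMk, indEval_linComp]
      rw [inv_apply, map_sum, ← one_smul k (α.1 v β), ← indEval_single,
        ← (h v β (Groupoid.inv β)).1, map_sum, LinearMap.sum_apply]
      simp only [← hmk, AddSubmonoidClass.coe_finsetSum, Finset.sum_apply]
  have (W : LinRep k H) (x : G) : IsIso ((hE.coindToInd.app W).app x) :=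
    (ConcreteCategory.isIso_iff_bijective _).2 (hbij W x)
  have (W : LinRep k H) : IsIso (hE.coindToInd.app W) := NatIso.isIso_of_isIso_app _
  have : IsIso hE.coindToInd := NatIso.isIso_of_isIso_app _
  exact ⟨(asIso hE.coindToInd).symm⟩

section OfNatTrans

variable (T : (coinductionFunctor φ : LinRep k H ⥤ LinRep k G) ⟶ inductionFunctor φ)

/-- The fibres of a morphism from co-induction to induction. -/
def coindToIndComponent (W : LinRep k H) (x : G) :
    ((coinductionFunctor φ).obj W).obj x →ₗ[k] indFibre φ W x :=
  ((T.app W).app x).hom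

theorem coindToIndComponent_naturality_left {W W' : LinRep k H} (f : W ⟶ W') {x : G}
    (z : ((coinductionFunctor φ).obj W).obj x) :
    coindToIndComponent T W' x ((((coinductionFunctor φ).map f).app x).hom z) =
      indFibreMap' φ f x (coindToIndComponent T W x z) :=
  congrArg (fun q => (q.app x).hom z) (T.naturality f)

theorem coindToIndComponent_naturality_right (W : LinRep k H) {x y : G} (g : x ⟶ y)
    (z : ((coinductionFunctor φ).obj W).obj x) :
    coindToIndComponent T W y ((((coinductionFunctor φ).obj W).map g).hom z) =
      indFibreMap φ W g (coindToIndComponent T W x z) :=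
  congrArg (fun q => q.hom z) ((T.app W).naturality g)

/-- The family `E(p) = T(p ⊗ 1)(1)` attached to a morphism `T` from co-induction to induction. -/
def kernelOfNatTrans (u v : H) (p : φ.obj u ⟶ φ.obj v) : (u ⟶ v) →₀ k :=
  (coindToIndComponent T (freeRep k u) (φ.obj v)
    (coindMk φ (freeRep k u) p (Finsupp.single (𝟙 u) 1))).1 v (𝟙 _)

/-- Every morphism from co-induction to induction is `b ⊗ w ↦ (β ↦ E(β b) w)` for its family `E`:
by naturality it is determined by its values at the generators of free representations. -/
theorem coindToIndComponent_coindMk (W : LinRep k H) {u v : H} {x : G} (b : φ.obj u ⟶ x)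
    (w : W.obj u) (β : x ⟶ φ.obj v) :
    (coindToIndComponent T W x (coindMk φ W b w)).1 v β =
      linAct W (kernelOfNatTrans T u v (b ≫ β)) w := by
  have h₁ := coind_map_app (freeRepHom W w) b (Finsupp.single (𝟙 u) 1)
  rw [freeRepHom_app, linAct_id] at h₁
  rw [← h₁, coindToIndComponent_naturality_left, kernelOfNatTrans, ← coind_obj_map,
    coindToIndComponent_naturality_right, ← freeRepHom_app]
  change ((freeRepHom W w).app v).hom ((coindToIndComponent T (freeRep k u) x
    (coindMk φ (freeRep k u) b (Finsupp.single (𝟙 u) 1))).1 v β) =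
    ((freeRepHom W w).app v).hom ((coindToIndComponent T (freeRep k u) x
    (coindMk φ (freeRep k u) b (Finsupp.single (𝟙 u) 1))).1 v (β ≫ 𝟙 _))
  rw [Category.comp_id]

/-- Contravariant naturality of `E` comes from the relation `p ⊗ h = p φ(h) ⊗ 1`, covariant
naturality from the definition of the induced representation. -/
theorem isBinatural_kernelOfNatTrans : IsBinatural (kernelOfNatTrans T) := by
  have left {u v u' : H} (h : u' ⟶ u) (p : φ.obj u ⟶ φ.obj v) :
      kernelOfNatTrans T u' v (φ.map h ≫ p) =
        Finsupp.mapDomain (fun a : u ⟶ v => h ≫ a) (kernelOfNatTrans T u v p) := by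
    have h₁ := coindMk_map (freeRep k u') h p (Finsupp.single (𝟙 u') 1)
    rw [freeRep_map, Finsupp.mapDomain_single, Category.id_comp] at h₁
    rw [kernelOfNatTrans, ← h₁, coindToIndComponent_coindMk, linAct_freeRep_single,
      Category.comp_id]
  have right {u v v' : H} (h : v ⟶ v') (p : φ.obj u ⟶ φ.obj v) :
      kernelOfNatTrans T u v' (p ≫ φ.map h) =
        Finsupp.mapDomain (fun a : u ⟶ v => a ≫ h) (kernelOfNatTrans T u v p) := by
    have h₁ := (coindToIndComponent T (freeRep k u) (φ.obj v)
      (coindMk φ (freeRep k u) p (Finsupp.single (𝟙 u) 1))).2 v v' h (𝟙 _)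
    rw [coindToIndComponent_coindMk, linAct_freeRep_single, Category.id_comp] at h₁
    simp only [Category.id_comp] at h₁
    exact (Finsupp.mapDomain_id (v := kernelOfNatTrans T u v' (p ≫ φ.map h))).symm.trans h₁
  intro u v u' v' h h' p
  rw [left, right, ← Finsupp.mapDomain_comp]
  rfl

end OfNatTrans

/-- The dual bases at `x` are read off from the element of the co-induced representation that
corresponds to the universal element `β ↦ β` of the representation induced from
`u ↦ kG(x, φ u)`. -/
theorem IsFrobeniusMorphism.hasDualBases (h : IsFrobeniusMorphism k φ) : HasDualBases k φ := by
  obtain ⟨θ⟩ := h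
  have hE := isBinatural_kernelOfNatTrans θ.inv
  refine ⟨kernelOfNatTrans θ.inv, hE, fun x => ?_⟩
  have hinj (W : LinRep k H) : Function.Injective (coindToIndComponent θ.inv W x) := by
    refine Function.LeftInverse.injective (g := ((θ.hom.app W).app x).hom) fun z => ?_
    exact congrArg (fun q => ((q.app W).app x).hom z) θ.inv_hom_id
  have hsurj (W : LinRep k H) : Function.Surjective (coindToIndComponent θ.inv W x) := by
    refine Function.RightInverse.surjective (g := ((θ.hom.app W).app x).hom) fun z => ?_
    exact congrArg (fun q => ((q.app W).app x).hom z) θ.hom_inv_id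
  -- the universal element `β ↦ β`
  let δ : indFibre φ (φ ⋙ freeRep k x) x :=
    ⟨fun v β => Finsupp.single β 1, fun u v h β =>
      (Finsupp.mapDomain_single (f := fun a => a ≫ φ.map h) (a := β) (b := (1 : k))).symm⟩
  obtain ⟨z, hz⟩ := hsurj _ δ
  obtain ⟨N, u, b, c, rfl⟩ := exists_sum_coindMk z
  refine ⟨N, u, b, c, fun v β β' => ⟨?_, ?_⟩⟩
  · have h₁ := congrArg (fun q : indFibre φ (φ ⋙ freeRep k x) x => q.1 v β) hz
    simp only [map_sum, AddSubmonoidClass.coe_finsetSum, Finset.sum_apply,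
      coindToIndComponent_coindMk] at h₁
    refine Eq.trans (Finset.sum_congr rfl fun i _ => ?_) h₁
    exact (linAct_comp_freeRep φ x _ (c i)).symm
  · -- right multiplication by `β'` followed by `E`, which is natural in the second variable
    let τ : φ ⋙ freeRep k x ⟶ freeRep k v :=
      { app w := ModuleCat.ofHom (Finsupp.linearCombination k (kernelOfNatTrans θ.inv v w) ∘ₗ
          (linComp k).flip (Finsupp.single β' 1))
        naturality w w' h := by
          refine ModuleCat.hom_ext (Finsupp.lhom_ext fun a r => ?_)
          change Finsupp.linearCombination k (kernelOfNatTrans θ.inv v w')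
              (linComp k (Finsupp.mapDomain (fun p => p ≫ φ.map h) (Finsupp.single a r))
                (Finsupp.single β' 1)) =
            Finsupp.mapDomain (fun p => p ≫ h) (Finsupp.linearCombination k
              (kernelOfNatTrans θ.inv v w)
                (linComp k (Finsupp.single a r) (Finsupp.single β' 1)))
          simp [linComp_single_single, ← Category.assoc, hE.map_comp_right,
            Finsupp.mapDomain_smul] }
    -- both sides have the image `β ↦ E(β β')` in the induced representation
    have h₂ : ∑ i, coindMk φ (freeRep k v) (b i) ((τ.app (u i)).hom (c i)) =
        coindMk φ (freeRep k v) β' (Finsupp.single (𝟙 v) 1) := by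
      refine hinj _ ?_
      have hτ : ∑ i, coindMk φ (freeRep k v) (b i) ((τ.app (u i)).hom (c i)) =
          (((coinductionFunctor φ).map τ).app x).hom (∑ i, coindMk φ _ (b i) (c i)) := by
        rw [map_sum]
        exact Finset.sum_congr rfl fun i _ => (coind_map_app τ (b i) (c i)).symm
      rw [hτ, coindToIndComponent_naturality_left, hz]
      refine Subtype.ext (funext fun w => funext fun β => ?_)
      rw [coindToIndComponent_coindMk, linAct_freeRep_single]
      change Finsupp.linearCombination k (kernelOfNatTrans θ.inv v w)
        (linComp k (Finsupp.single β 1) (Finsupp.single β' 1)) = _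
      simp only [linComp_single_single, Category.id_comp, mul_one,
        Finsupp.linearCombination_single, one_smul]
      exact Finsupp.mapDomain_id.symm
    -- the map `p ⊗ e ↦ p φ(e)`
    let μ : ((coinductionFunctor φ).obj (freeRep k v)).obj x →ₗ[k] ((φ.obj v ⟶ x) →₀ k) :=
      coindDesc (fun w p => linComp k (Finsupp.single p 1) ∘ₗ linMap k φ) fun w w' h p e => by
        rw [freeRep_map]
        change linComp k (Finsupp.single p 1) (linMap k φ _) =
          linComp k (Finsupp.single (φ.map h ≫ p) 1) (linMap k φ e)
        induction e using Finsupp.induction_linear with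
        | zero => simp
        | add e f he hf => simp only [Finsupp.mapDomain_add, map_add, he, hf]
        | single a r => simp [linMap_single, linComp_single_single]
    have hμ {w : H} (p : φ.obj w ⟶ x) (e : (v ⟶ w) →₀ k) :
        μ (coindMk φ (freeRep k v) p e) = linComp k (Finsupp.single p 1) (linMap k φ e) :=
      coindDesc_coindMk (W := freeRep k v)
        (fun w p => linComp k (Finsupp.single p 1) ∘ₗ linMap k φ) _ p e
    have h₃ := congrArg μ h₂
    rw [map_sum, hμ, linMap_single, linComp_single_single] at h₃
    refine Eq.trans ?_ (h₃.symm.trans (Finset.sum_congr rfl fun i _ => hμ _ _))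
    simp

end FrobeniusDualBases

/-! ### Calculus in path algebras -/

namespace PathAlgebra

section Basic

variable {k : Type u} [Field k] {C D : Type u} [Category.{u} C] [Category.{u} D]

theorem induction_linear {P : PathAlgebra k C → Prop} (a : PathAlgebra k C) (zero : P 0)
    (add : ∀ a b, P a → P b → P (a + b))
    (smul_of : ∀ (r : k) (x y : C) (f : x ⟶ y), P (r • of k f)) : P a := by
  refine Finsupp.induction_linear (motive := P) a zero add fun f r => ?_
  obtain ⟨x, y, f⟩ := f
  have h : (Finsupp.single ⟨x, y, f⟩ r : Arr C →₀ k) = r • Finsupp.single ⟨x, y, f⟩ 1 := by simp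
  rw [h]
  exact smul_of r x y f

/-- The inclusion of the linearised hom-set `kC(x, y)`. -/
def homEmb {x y : C} : ((x ⟶ y) →₀ k) →ₗ[k] PathAlgebra k C :=
  Finsupp.linearCombination k fun f => of k f

theorem homEmb_single {x y : C} (f : x ⟶ y) (r : k) :
    homEmb (Finsupp.single f r) = r • of k f := by
  simp [homEmb]

theorem arr_mk_injective (x y : C) : Function.Injective fun f : x ⟶ y => (⟨x, y, f⟩ : Arr C) := by
  intro f g h
  simpa using h

/-- The component of an element of the path algebra in `kC(x, y)`. -/
def coeff (x y : C) : PathAlgebra k C →ₗ[k] ((x ⟶ y) →₀ k) :=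
  Finsupp.lcomapDomain (fun f : x ⟶ y => (⟨x, y, f⟩ : Arr C)) (arr_mk_injective x y)

theorem coeff_apply (x y : C) (a : PathAlgebra k C) (f : x ⟶ y) :
    coeff x y a f = (show Arr C →₀ k from a) ⟨x, y, f⟩ := rfl

theorem coeff_of {x y : C} (f : x ⟶ y) : coeff x y (of k f) = Finsupp.single f 1 := by
  classical
  ext g
  rw [coeff_apply]
  change (Finsupp.single _ _ : Arr C →₀ k) _ = _
  simp [Finsupp.single_apply]

theorem coeff_of_ne {x y x' y' : C} (f : x' ⟶ y') (h : ¬ (x' = x ∧ y' = y)) :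
    coeff x y (of k f) = 0 := by
  classical
  ext g
  rw [coeff_apply]
  refine Finsupp.single_eq_of_ne fun e => h ?_
  simp only [Sigma.mk.injEq] at e
  obtain ⟨rfl, e⟩ := e
  simp only [heq_eq_eq, Sigma.mk.injEq] at e
  exact ⟨rfl, e.1.symm⟩

theorem coeff_homEmb {x y : C} (e : (x ⟶ y) →₀ k) : coeff x y (homEmb e) = e := by
  induction e using Finsupp.induction_linear with
  | zero => simp
  | add e f he hf => simp [he, hf]
  | single f r => simp [homEmb_single, coeff_of]

theorem homEmb_injective {x y : C} :
    Function.Injective (homEmb : ((x ⟶ y) →₀ k) →ₗ[k] PathAlgebra k C) :=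
  Function.LeftInverse.injective coeff_homEmb

theorem idem_mul_of {x y : C} (f : x ⟶ y) : idem k y * of k f = of k f := by
  rw [idem, of_mul_of, Category.comp_id]

theorem of_mul_idem {x y : C} (f : x ⟶ y) : of k f * idem k x = of k f := by
  rw [idem, of_mul_of, Category.id_comp]

theorem idem_mul_idem (x : C) : idem k x * idem k x = idem k x := of_mul_idem _

theorem idem_mul_of_ne {x y z : C} (f : x ⟶ y) (h : y ≠ z) : idem k z * of k f = 0 :=
  of_mul_of_ne k _ _ h

theorem of_mul_idem_ne {x y z : C} (f : x ⟶ y) (h : z ≠ x) : of k f * idem k z = 0 :=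
  of_mul_of_ne k _ _ h

theorem homEmb_coeff (x y : C) (a : PathAlgebra k C) :
    homEmb (coeff x y a) = idem k y * a * idem k x := by
  induction a using induction_linear with
  | zero => simp
  | add a b ha hb => simp only [map_add, ha, hb, mul_add, add_mul]
  | smul_of r x' y' f =>
    rw [map_smul, map_smul, mul_smul_comm, smul_mul_assoc]
    congr 1
    by_cases h : x' = x ∧ y' = y
    · obtain ⟨rfl, rfl⟩ := h
      rw [coeff_of, homEmb_single, one_smul, idem_mul_of, of_mul_idem]
    · rw [coeff_of_ne f h, map_zero]
      by_cases hy : y' = y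
      · subst hy
        rw [idem_mul_of, of_mul_idem_ne f fun e => h ⟨e.symm, rfl⟩]
      · rw [idem_mul_of_ne f hy, zero_mul]

theorem idem_mul_homEmb {x y : C} (e : (x ⟶ y) →₀ k) : idem k y * homEmb e = homEmb e := by
  rw [← coeff_homEmb e, homEmb_coeff, ← mul_assoc, ← mul_assoc, idem_mul_idem]

theorem homEmb_mul_idem {x y : C} (e : (x ⟶ y) →₀ k) : homEmb e * idem k x = homEmb e := by
  rw [← coeff_homEmb e, homEmb_coeff, mul_assoc, idem_mul_idem]

theorem homEmb_linComp {x y z : C} (p : (y ⟶ z) →₀ k) (q : (x ⟶ y) →₀ k) :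
    homEmb (linComp k p q) = homEmb p * homEmb q := by
  induction p using Finsupp.induction_linear with
  | zero => simp
  | add p p' hp hp' => simp only [map_add, LinearMap.add_apply, hp, hp', add_mul]
  | single p r =>
    induction q using Finsupp.induction_linear with
    | zero => simp
    | add q q' hq hq' => simp only [map_add, hq, hq', mul_add]
    | single q s =>
      rw [linComp_single_single, homEmb_single, homEmb_single, homEmb_single, smul_mul_assoc,
        mul_smul_comm, smul_smul, of_mul_of]

theorem homEmb_mapDomain {x y x' y' : C} (h : x' ⟶ x) (h' : y ⟶ y') (e : (x ⟶ y) →₀ k) :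
    homEmb (Finsupp.mapDomain (fun a => h ≫ a ≫ h') e) = of k h' * homEmb e * of k h := by
  induction e using Finsupp.induction_linear with
  | zero => simp
  | add p p' hp hp' => simp only [Finsupp.mapDomain_add, map_add, hp, hp', mul_add, add_mul]
  | single p r =>
    rw [Finsupp.mapDomain_single, homEmb_single, homEmb_single, mul_smul_comm, smul_mul_assoc,
      of_mul_of, of_mul_of]

theorem map_of (F : C ⥤ D) (hF : Function.Injective F.obj) {x y : C} (f : x ⟶ y) :
    map k F hF (of k f) = of k (F.map f) :=
  mapLin_of k F f

theorem map_idem (F : C ⥤ D) (hF : Function.Injective F.obj) (x : C) :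
    map k F hF (idem k x) = idem k (F.obj x) := by
  rw [idem, map_of, F.map_id, idem]

theorem homEmb_linMap (F : C ⥤ D) (hF : Function.Injective F.obj) {x y : C} (e : (x ⟶ y) →₀ k) :
    homEmb (linMap k F e) = map k F hF (homEmb e) := by
  induction e using Finsupp.induction_linear with
  | zero => simp
  | add p p' hp hp' => simp only [map_add, hp, hp']
  | single p r => rw [linMap_single, homEmb_single, homEmb_single, map_smul, map_of]

theorem eq_zero_of_idem_mul {a : PathAlgebra k C} (h : ∀ y, idem k y * a = 0) : a = 0 := by
  refine Finsupp.ext fun f => ?_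
  obtain ⟨x, y, f⟩ := f
  have h₁ : coeff x y a = 0 :=
    homEmb_injective (by rw [homEmb_coeff, h, zero_mul, map_zero])
  exact congrArg (fun e => e f) h₁

/-- Path algebras have local units. The quantification over all larger sets `T` allows the units of
finitely many elements to be combined. -/
theorem exists_sum_idem_mul (a : PathAlgebra k C) :
    ∃ S : Finset C, ∀ T : Finset C, S ⊆ T → (∑ y ∈ T, idem k y) * a = a := by
  classical
  induction a using induction_linear with
  | zero => exact ⟨∅, fun T _ => mul_zero _⟩
  | add a b ha hb =>
    obtain ⟨S, hS⟩ := ha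
    obtain ⟨S', hS'⟩ := hb
    refine ⟨S ∪ S', fun T hT => ?_⟩
    rw [mul_add, hS T (Finset.union_subset_left hT), hS' T (Finset.union_subset_right hT)]
  | smul_of r x y f =>
    refine ⟨{y}, fun T hT => ?_⟩
    rw [mul_smul_comm, Finset.sum_mul, Finset.sum_eq_single_of_mem y (hT (by simp)),
      idem_mul_of]
    exact fun z _ hz => idem_mul_of_ne f hz.symm

end Basic

section Extension

variable {k : Type u} [Field k] {H G : Type u} [Category.{u} H] [Category.{u} G] {φ : H ⥤ G}
  {hφ : Function.Injective φ.obj}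

theorem of_mem_ABIdemSpace {x : G} {v : H} (β : x ⟶ φ.obj v) :
    of k β ∈ ABIdemSpace k φ hφ x :=
  Submodule.subset_span ⟨idem k v, of k β, by rw [map_idem, idem_mul_of, of_mul_idem]⟩

/-- `A B 1_x` is spanned by the arrows from `x` to objects in the image of `φ`. -/
theorem ABIdemSpace_le {x : G} {N : Submodule k (PathAlgebra k G)}
    (h : ∀ (v : H) (β : x ⟶ φ.obj v), of k β ∈ N) : ABIdemSpace k φ hφ x ≤ N := by
  refine Submodule.span_le.2 ?_
  rintro _ ⟨a, b, rfl⟩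
  change _ ∈ N
  induction a using induction_linear with
  | zero => simp
  | add a a' ha ha' => simpa only [map_add, add_mul] using N.add_mem ha ha'
  | smul_of r v v' f =>
    induction b using induction_linear with
    | zero => simp
    | add b b' hb hb' => simpa only [mul_add, add_mul] using N.add_mem hb hb'
    | smul_of s y z g =>
      rw [map_smul, mul_smul_comm, smul_mul_assoc, smul_mul_assoc, smul_mul_assoc, map_of]
      refine N.smul_mem _ (N.smul_mem _ ?_)
      by_cases hz : z = φ.obj v
      · subst hz
        rw [of_mul_of]
        by_cases hx : x = y
        · subst hx
          rw [of_mul_idem]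
          exact h _ _
        · rw [of_mul_idem_ne _ hx]
          exact N.zero_mem
      · rw [of_mul_of_ne k _ _ hz, zero_mul]
        exact N.zero_mem

theorem ABIdemSpace_le_ABSpace (x : G) : ABIdemSpace k φ hφ x ≤ ABSpace k φ hφ :=
  ABIdemSpace_le fun v β => Submodule.subset_span ⟨idem k v, of k β, by rw [map_idem, idem_mul_of]⟩

theorem mul_idem_mem_ABIdemSpace {m : PathAlgebra k G} (hm : m ∈ ABSpace k φ hφ) (x : G) :
    m * idem k x ∈ ABIdemSpace k φ hφ x := by
  refine (Submodule.span_le (p := (ABIdemSpace k φ hφ x).comap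
    (LinearMap.mulRight k (idem k x)))).2 ?_ hm
  rintro _ ⟨a, b, rfl⟩
  exact Submodule.subset_span ⟨a, b, rfl⟩

theorem mul_idem_of_mem_ABIdemSpace {x : G} {m : PathAlgebra k G}
    (hm : m ∈ ABIdemSpace k φ hφ x) : m * idem k x = m := by
  refine ABIdemSpace_le (N := LinearMap.eqLocus (LinearMap.mulRight k (idem k x)) LinearMap.id)
    (fun v β => ?_) hm
  exact of_mul_idem β

/-- Local units of `A` act as local units on `A B`. -/
theorem exists_sum_idem_mul_of_mem_ABSpace {m : PathAlgebra k G} (hm : m ∈ ABSpace k φ hφ) :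
    ∃ S : Finset H, ∀ T : Finset H, S ⊆ T → (∑ v ∈ T, idem k (φ.obj v)) * m = m := by
  classical
  induction hm using Submodule.span_induction with
  | zero => exact ⟨∅, fun T _ => mul_zero _⟩
  | add a b _ _ ha hb =>
    obtain ⟨S, hS⟩ := ha
    obtain ⟨S', hS'⟩ := hb
    refine ⟨S ∪ S', fun T hT => ?_⟩
    rw [mul_add, hS T (Finset.union_subset_left hT), hS' T (Finset.union_subset_right hT)]
  | smul r a _ ha =>
    obtain ⟨S, hS⟩ := ha
    exact ⟨S, fun T hT => by rw [mul_smul_comm, hS T hT]⟩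
  | mem m hm =>
    obtain ⟨a, b, rfl⟩ := hm
    obtain ⟨S, hS⟩ := exists_sum_idem_mul a
    refine ⟨S, fun T hT => ?_⟩
    simp only [← map_idem φ hφ]
    rw [← mul_assoc, ← map_sum, ← map_mul, hS T hT]

variable (φ) in
/-- The arrows of `G` between objects in the image of `φ`. -/
def imageArr (t : Σ u v : H, (φ.obj u ⟶ φ.obj v)) : Arr G := ⟨φ.obj t.1, φ.obj t.2.1, t.2.2⟩

theorem imageArr_injective (hφ : Function.Injective φ.obj) : Function.Injective (imageArr φ) := by
  rintro ⟨u, v, p⟩ ⟨u', v', p'⟩ h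
  simp only [imageArr, Sigma.mk.injEq] at h
  obtain ⟨hu, h⟩ := h
  obtain rfl := hφ hu
  simp only [heq_eq_eq, Sigma.mk.injEq] at h
  obtain ⟨hv, h⟩ := h
  obtain rfl := hφ hv
  simpa using h

/-- The linear map `B → A` defined by a family `E`, extended by zero to the arrows whose source or
target is not in the image of `φ`. The extension by zero is the only one that can be a homomorphism
of `A`-bimodules; it is well defined on arrows if `φ` is injective on objects. -/
def extendKernel (E : ∀ u v : H, (φ.obj u ⟶ φ.obj v) → ((u ⟶ v) →₀ k)) :
    PathAlgebra k G →ₗ[k] PathAlgebra k H :=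
  Finsupp.linearCombination k
    (Function.extend (imageArr φ) (fun t => homEmb (E t.1 t.2.1 t.2.2)) 0)

variable {E : ∀ u v : H, (φ.obj u ⟶ φ.obj v) → ((u ⟶ v) →₀ k)}

theorem extendKernel_of' {x y : G} (p : x ⟶ y) : extendKernel E (of k p) =
    Function.extend (imageArr φ) (fun t => homEmb (E t.1 t.2.1 t.2.2)) 0 ⟨x, y, p⟩ := by
  rw [extendKernel, of]
  erw [Finsupp.linearCombination_single, one_smul]

theorem extendKernel_of (hφ : Function.Injective φ.obj) {u v : H} (p : φ.obj u ⟶ φ.obj v) :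
    extendKernel E (of k p) = homEmb (E u v p) := by
  rw [extendKernel_of']
  exact (imageArr_injective hφ).extend_apply _ _ ⟨u, v, p⟩

theorem extendKernel_of_source {x y : G} (p : x ⟶ y) (hx : ∀ u, φ.obj u ≠ x) :
    extendKernel E (of k p) = 0 := by
  rw [extendKernel_of', Function.extend_apply']
  · rfl
  · rintro ⟨⟨u, v, q⟩, h⟩
    exact hx u (congrArg Sigma.fst h)

theorem extendKernel_of_target {x y : G} (p : x ⟶ y) (hy : ∀ u, φ.obj u ≠ y) :
    extendKernel E (of k p) = 0 := by
  rw [extendKernel_of', Function.extend_apply']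
  · rfl
  · rintro ⟨⟨u, v, q⟩, h⟩
    exact hy v (congrArg (fun t : Arr G => t.2.1) h)

theorem extendKernel_map_mul (hE : IsBinatural E) (a : PathAlgebra k H) (b : PathAlgebra k G) :
    extendKernel E (map k φ hφ a * b) = a * extendKernel E b := by
  induction a using induction_linear with
  | zero => simp
  | add a a' ha ha' => simp only [map_add, add_mul, ha, ha']
  | smul_of r v v' h =>
    rw [map_smul, smul_mul_assoc, map_smul, smul_mul_assoc, map_of]
    congr 1
    induction b using induction_linear with
    | zero => simp
    | add b b' hb hb' => simp only [map_add, mul_add, hb, hb']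
    | smul_of s x y p =>
      rw [mul_smul_comm, map_smul, map_smul, mul_smul_comm]
      congr 1
      by_cases hx : ∃ u, φ.obj u = x
      · obtain ⟨u, rfl⟩ := hx
        by_cases hy : ∃ w, φ.obj w = y
        · obtain ⟨w, rfl⟩ := hy
          rw [extendKernel_of hφ, ← idem_mul_homEmb, ← mul_assoc]
          by_cases hw : w = v
          · subst hw
            rw [of_mul_of, extendKernel_of hφ, hE.map_comp_right, of_mul_idem]
            have := homEmb_mapDomain (𝟙 u) h (E u w p)
            simp only [Category.id_comp] at this
            rw [this, ← idem, mul_assoc, homEmb_mul_idem]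
          · rw [of_mul_of_ne k _ _ fun e => hw (hφ e), map_zero, of_mul_idem_ne _ hw, zero_mul]
        · push Not at hy
          rw [extendKernel_of_target p hy, mul_zero, of_mul_of_ne k _ _ (hy v).symm, map_zero]
      · push Not at hx
        rw [extendKernel_of_source p hx, mul_zero]
        by_cases hy : y = φ.obj v
        · subst hy
          rw [of_mul_of, extendKernel_of_source _ hx]
        · rw [of_mul_of_ne k _ _ hy, map_zero]

theorem extendKernel_mul_map (hE : IsBinatural E) (a : PathAlgebra k H) (b : PathAlgebra k G) :
    extendKernel E (b * map k φ hφ a) = extendKernel E b * a := by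
  induction a using induction_linear with
  | zero => simp
  | add a a' ha ha' => simp only [map_add, mul_add, ha, ha']
  | smul_of r u' u h =>
    rw [map_smul, mul_smul_comm, map_smul, mul_smul_comm, map_of]
    congr 1
    induction b using induction_linear with
    | zero => simp
    | add b b' hb hb' => simp only [map_add, add_mul, hb, hb']
    | smul_of s x y p =>
      rw [smul_mul_assoc, map_smul, map_smul, smul_mul_assoc]
      congr 1
      by_cases hy : ∃ v, φ.obj v = y
      · obtain ⟨v, rfl⟩ := hy
        by_cases hx : ∃ w, φ.obj w = x
        · obtain ⟨w, rfl⟩ := hx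
          rw [extendKernel_of hφ, ← homEmb_mul_idem, mul_assoc]
          by_cases hw : u = w
          · subst hw
            rw [of_mul_of, extendKernel_of hφ, hE.map_comp_left, idem_mul_of]
            have := homEmb_mapDomain h (𝟙 v) (E u v p)
            simp only [Category.comp_id] at this
            rw [this, ← idem, idem_mul_homEmb]
          · rw [of_mul_of_ne k _ _ fun e => hw (hφ e), map_zero, idem_mul_of_ne _ hw, mul_zero]
        · push Not at hx
          rw [extendKernel_of_source p hx, zero_mul, of_mul_of_ne k _ _ (hx u), map_zero]
      · push Not at hy
        rw [extendKernel_of_target p hy, zero_mul]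
        by_cases hx : φ.obj u = x
        · subst hx
          rw [of_mul_of, extendKernel_of_target _ hy]
        · rw [of_mul_of_ne k _ _ hx, map_zero]

end Extension

/-! ### Dual bases inside the path algebra -/

section DualBasis

variable {k : Type u} [Field k] {H G : Type u} [Category.{u} H] [Category.{u} G] {φ : H ⥤ G}
  {hφ : Function.Injective φ.obj}

variable (hφ) in
/-- The families `b i ∈ 1_x B 1_(u i)` and `c i ∈ 1_(u i) B 1_x` are dual bases at `x` for the map
`E : B → A`, which is meant to be a homomorphism of `A`-bimodules. -/
structure IsDualBasis (E : PathAlgebra k G →ₗ[k] PathAlgebra k H) (x : G) {ι : Type*} [Fintype ι]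
    (u : ι → H) (b c : ι → PathAlgebra k G) : Prop where
  idem_mul_left : ∀ i, idem k x * b i = b i
  left_mul_idem : ∀ i, b i * idem k (φ.obj (u i)) = b i
  idem_mul_right : ∀ i, idem k (φ.obj (u i)) * c i = c i
  right_mem : ∀ i, c i ∈ ABIdemSpace k φ hφ x
  sum_right : ∀ m ∈ ABIdemSpace k φ hφ x, ∑ i, map k φ hφ (E (m * b i)) * c i = m
  sum_left : ∀ (v : H) (b' : PathAlgebra k G),
    ∑ i, b i * map k φ hφ (E (c i * (b' * idem k (φ.obj v)))) =
      idem k x * (b' * idem k (φ.obj v))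

theorem homEmb_mem_ABIdemSpace {x : G} {v : H} (c : (x ⟶ φ.obj v) →₀ k) :
    homEmb c ∈ ABIdemSpace k φ hφ x := by
  induction c using Finsupp.induction_linear with
  | zero => rw [map_zero]; exact Submodule.zero_mem _
  | add e f he hf => rw [map_add]; exact Submodule.add_mem _ he hf
  | single a r => rw [homEmb_single]; exact Submodule.smul_mem _ _ (of_mem_ABIdemSpace a)

variable {E : ∀ u v : H, (φ.obj u ⟶ φ.obj v) → ((u ⟶ v) →₀ k)}

theorem map_extendKernel_of_mul_homEmb {x : G} {u v : H} (p : φ.obj u ⟶ φ.obj v)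
    (c : (x ⟶ φ.obj u) →₀ k) :
    map k φ hφ (extendKernel E (of k p)) * homEmb c =
      homEmb (linComp k (linMap k φ (E u v p)) c) := by
  rw [extendKernel_of hφ, ← homEmb_linMap, homEmb_linComp]

theorem extendKernel_homEmb {u v : H} (hφ : Function.Injective φ.obj)
    (e : (φ.obj u ⟶ φ.obj v) →₀ k) :
    extendKernel E (homEmb e) = homEmb (Finsupp.linearCombination k (E u v) e) := by
  induction e using Finsupp.induction_linear with
  | zero => simp
  | add e f he hf => simp only [map_add, he, hf]
  | single a r =>
    rw [homEmb_single, map_smul, extendKernel_of hφ, Finsupp.linearCombination_single, map_smul]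

theorem of_mul_map_extendKernel {x : G} {u v : H} (b : φ.obj u ⟶ x) (c : (x ⟶ φ.obj u) →₀ k)
    (β : φ.obj v ⟶ x) :
    of k b * map k φ hφ (extendKernel E (homEmb c * of k β)) =
      homEmb (linComp k (Finsupp.single b 1) (linMap k φ (Finsupp.linearCombination k (E v u)
        (linComp k c (Finsupp.single β 1))))) := by
  have h (y z : G) (f : y ⟶ z) : of k f = homEmb (Finsupp.single f 1) := by
    rw [homEmb_single, one_smul]
  rw [h _ _ β, ← homEmb_linComp, extendKernel_homEmb hφ, ← homEmb_linMap, h, homEmb_linComp]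

theorem isDualBasis_of_arrows {x : G} {ι : Type*} [Fintype ι] {u : ι → H}
    {b : ∀ i, φ.obj (u i) ⟶ x} {c : ∀ i, (x ⟶ φ.obj (u i)) →₀ k}
    (h₁ : ∀ (v : H) (β : x ⟶ φ.obj v),
      ∑ i, linComp k (linMap k φ (E (u i) v (b i ≫ β))) (c i) = Finsupp.single β 1)
    (h₂ : ∀ (v : H) (β : φ.obj v ⟶ x), Finsupp.single β 1 = ∑ i, linComp k (Finsupp.single (b i) 1)
      (linMap k φ (Finsupp.linearCombination k (E v (u i))
        (linComp k (c i) (Finsupp.single β 1))))) :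
    IsDualBasis hφ (extendKernel E) x u (fun i => of k (b i)) fun i => homEmb (c i) where
  idem_mul_left i := idem_mul_of _
  left_mul_idem i := of_mul_idem _
  idem_mul_right i := idem_mul_homEmb _
  right_mem i := homEmb_mem_ABIdemSpace _
  sum_right m hm := by
    let L : PathAlgebra k G →ₗ[k] PathAlgebra k G := ∑ i,
      LinearMap.mulRight k (homEmb (c i)) ∘ₗ mapLin k φ ∘ₗ extendKernel E ∘ₗ
        LinearMap.mulRight k (of k (b i))
    have hL (m) : L m = ∑ i, map k φ hφ (extendKernel E (m * of k (b i))) * homEmb (c i) := by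
      simp only [L, LinearMap.sum_apply]
      rfl
    rw [← hL]
    refine ABIdemSpace_le (N := LinearMap.eqLocus L LinearMap.id) (fun v β => ?_) hm
    change L (of k β) = of k β
    simp only [hL, of_mul_of, map_extendKernel_of_mul_homEmb]
    rw [← map_sum, h₁, homEmb_single, one_smul]
  sum_left v b' := by
    induction b' using induction_linear with
    | zero => simp
    | add a b ha hb => simp only [add_mul, mul_add, map_add, Finset.sum_add_distrib, ha, hb]
    | smul_of r y z β =>
      simp only [smul_mul_assoc, mul_smul_comm, map_smul, ← Finset.smul_sum]
      congr 1
      by_cases hy : φ.obj v = y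
      · subst hy
        rw [of_mul_idem]
        by_cases hz : z = x
        · subst hz
          simp only [of_mul_map_extendKernel]
          rw [← map_sum, ← h₂, homEmb_single, one_smul, idem_mul_of]
        · rw [idem_mul_of_ne _ hz]
          refine Finset.sum_eq_zero fun i _ => ?_
          rw [← homEmb_mul_idem, mul_assoc (homEmb (c i)), idem_mul_of_ne _ hz, mul_zero, map_zero,
            map_zero, mul_zero]
      · simp [of_mul_idem_ne _ hy]

/-- The members of a dual basis can be expanded into arrows. -/
theorem IsDualBasis.exists_arrows {x : G} {ι : Type u} [Fintype ι] {u : ι → H}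
    {b c : ι → PathAlgebra k G} (h : IsDualBasis hφ (extendKernel E) x u b c) :
    ∃ (N : ℕ) (u : Fin N → H) (b : ∀ i, φ.obj (u i) ⟶ x) (c : ∀ i, (x ⟶ φ.obj (u i)) →₀ k),
      ∀ (v : H) (β : x ⟶ φ.obj v) (β' : φ.obj v ⟶ x),
        (∑ i, linComp k (linMap k φ (E (u i) v (b i ≫ β))) (c i) = Finsupp.single β 1) ∧
        (Finsupp.single β' 1 = ∑ i, linComp k (Finsupp.single (b i) 1)
          (linMap k φ (Finsupp.linearCombination k (E v (u i))
            (linComp k (c i) (Finsupp.single β' 1))))) := by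
  let e (i : ι) : (φ.obj (u i) ⟶ x) →₀ k := coeff (φ.obj (u i)) x (b i)
  let d (i : ι) : (x ⟶ φ.obj (u i)) →₀ k := coeff x (φ.obj (u i)) (c i)
  have he (i) : homEmb (e i) = b i := by
    rw [homEmb_coeff, h.idem_mul_left, h.left_mul_idem]
  have hd (i) : homEmb (d i) = c i := by
    rw [homEmb_coeff, h.idem_mul_right, mul_idem_of_mem_ABIdemSpace (h.right_mem i)]
  let J := Σ i : ι, (e i).support
  let s : Fin (Fintype.card J) ≃ J := (Fintype.equivFin J).symm
  have hsum (F : ι → PathAlgebra k G →ₗ[k] PathAlgebra k G) :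
      ∑ j : Fin (Fintype.card J), (e (s j).1 (s j).2.1) • F (s j).1 (of k (s j).2.1) =
        ∑ i, F i (b i) := by
    rw [s.sum_comp (fun t : J => e t.1 t.2.1 • F t.1 (of k t.2.1)), Fintype.sum_sigma]
    refine Finset.sum_congr rfl fun i _ => ?_
    rw [Finset.sum_coe_sort (e i).support (fun p => e i p • F i (of k p)), ← he i, homEmb,
      Finsupp.linearCombination_apply, Finsupp.sum, map_sum]
    simp only [map_smul]
  refine ⟨Fintype.card J, fun j => u (s j).1, fun j => (s j).2.1,
    fun j => e (s j).1 (s j).2.1 • d (s j).1, fun v β β' => ⟨?_, ?_⟩⟩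
  · apply homEmb_injective
    have h₁ := hsum fun i => LinearMap.mulRight k (c i) ∘ₗ mapLin k φ ∘ₗ extendKernel E ∘ₗ
      LinearMap.mulLeft k (of k β)
    have h₂ := h.sum_right (of k β) (of_mem_ABIdemSpace β)
    rw [homEmb_single, one_smul]
    refine Eq.trans ?_ (h₁.trans h₂)
    rw [map_sum]
    refine Finset.sum_congr rfl fun j _ => ?_
    rw [map_smul, map_smul, ← map_extendKernel_of_mul_homEmb (hφ := hφ), hd, ← of_mul_of]
    rfl
  · apply homEmb_injective
    have h₁ := hsum fun i => LinearMap.mulRight k (map k φ hφ (extendKernel E (c i * of k β')))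
    have h₂ := h.sum_left v (of k β')
    rw [of_mul_idem, idem_mul_of] at h₂
    rw [homEmb_single, one_smul]
    refine h₂.symm.trans (h₁.symm.trans ?_)
    rw [map_sum]
    refine Finset.sum_congr rfl fun j _ => ?_
    rw [← of_mul_map_extendKernel (hφ := hφ), map_smul, hd, smul_mul_assoc, map_smul, map_smul,
      mul_smul_comm]
    rfl

end DualBasis

/-! ### The modules `A B 1_x`, `A 1_u` and `B Hom_A(AB, A 1_u)` -/

section Modules

variable {k : Type u} [Field k]

/-- The inclusion of `R 1_x` into the path algebra `R`. -/
def leftIdeal.valLin {C : Type u} [Category.{u} C] (x : C) : leftIdeal k x →ₗ[k] PathAlgebra k C :=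
  (LinearMap.range (LinearMap.mulRight k (idem k x))).subtype

/-- The projection `a ↦ a 1_x` of the path algebra `R` onto `R 1_x`. -/
def leftIdeal.proj {C : Type u} [Category.{u} C] (x : C) : PathAlgebra k C →ₗ[k] leftIdeal k x :=
  (LinearMap.mulRight k (idem k x)).rangeRestrict

theorem leftIdeal.valLin_injective {C : Type u} [Category.{u} C] (x : C) :
    Function.Injective (leftIdeal.valLin (k := k) x) :=
  Subtype.val_injective

theorem leftIdeal.valLin_proj {C : Type u} [Category.{u} C] (x : C) (a : PathAlgebra k C) :
    leftIdeal.valLin x (leftIdeal.proj x a) = a * idem k x := rfl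

theorem leftIdeal.valLin_mul_idem {C : Type u} [Category.{u} C] {x : C} (a : leftIdeal k x) :
    leftIdeal.valLin x a * idem k x = leftIdeal.valLin x a := by
  obtain ⟨_, b, rfl⟩ := a
  change b * idem k x * idem k x = b * idem k x
  rw [mul_assoc, idem_mul_idem]

theorem leftIdeal.proj_valLin {C : Type u} [Category.{u} C] {x : C} (a : leftIdeal k x) :
    leftIdeal.proj x (leftIdeal.valLin x a) = a :=
  leftIdeal.valLin_injective x (leftIdeal.valLin_mul_idem a)

theorem leftIdeal.valLin_act {C : Type u} [Category.{u} C] {x : C} (r : PathAlgebra k C)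
    (a : leftIdeal k x) :
    leftIdeal.valLin x ((leftIdeal k x).act r a) = r * leftIdeal.valLin x a := rfl

theorem leftIdeal.valLin_mulArrow {C : Type u} [Category.{u} C] {x y : C} (f : x ⟶ y)
    (a : leftIdeal k y) :
    leftIdeal.valLin x (leftIdeal.mulArrow k f a) = leftIdeal.valLin y a * of k f := rfl

variable {H G : Type u} [Category.{u} H] [Category.{u} G] {φ : H ⥤ G}
  {hφ : Function.Injective φ.obj}

variable (k φ hφ) in
/-- The inclusion of `A B` into `B`. -/
def AB.valLin : AB k φ hφ →ₗ[k] PathAlgebra k G := (ABSpace k φ hφ).subtype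

theorem AB.valLin_injective : Function.Injective (AB.valLin k φ hφ) := Subtype.val_injective

theorem AB.valLin_mem (m : AB k φ hφ) : AB.valLin k φ hφ m ∈ ABSpace k φ hφ := m.2

theorem AB.valLin_act (a : PathAlgebra k H) (m : AB k φ hφ) :
    AB.valLin k φ hφ ((AB k φ hφ).act a m) = map k φ hφ a * AB.valLin k φ hφ m := rfl

theorem AB.valLin_mulRight (b : PathAlgebra k G) (m : AB k φ hφ) :
    AB.valLin k φ hφ (AB.mulRight k φ hφ b m) = AB.valLin k φ hφ m * b := rfl

variable (k φ hφ) in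
/-- The inclusion of `A B 1_x` into `B`. -/
def ABIdem.valLin (x : G) : ABIdem k φ hφ x →ₗ[k] PathAlgebra k G := (ABIdemSpace k φ hφ x).subtype

theorem ABIdem.valLin_injective (x : G) : Function.Injective (ABIdem.valLin k φ hφ x) :=
  Subtype.val_injective

theorem ABIdem.valLin_mem {x : G} (m : ABIdem k φ hφ x) :
    ABIdem.valLin k φ hφ x m ∈ ABIdemSpace k φ hφ x := m.2

theorem ABIdem.valLin_act {x : G} (a : PathAlgebra k H) (m : ABIdem k φ hφ x) :
    ABIdem.valLin k φ hφ x ((ABIdem k φ hφ x).act a m) =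
      map k φ hφ a * ABIdem.valLin k φ hφ x m := rfl

variable (k φ hφ) in
/-- The inclusion of `A B 1_x` into `A B`. -/
def ABIdem.toAB (x : G) : ABIdem k φ hφ x →ₗ[k] AB k φ hφ :=
  LinearMap.codRestrict (ABSpace k φ hφ) (ABIdem.valLin k φ hφ x) fun m =>
    ABIdemSpace_le_ABSpace x (ABIdem.valLin_mem m)

theorem ABIdem.valLin_toAB {x : G} (m : ABIdem k φ hφ x) :
    AB.valLin k φ hφ (ABIdem.toAB k φ hφ x m) = ABIdem.valLin k φ hφ x m := 
  LinearMap.codRestrict_apply (ABSpace k φ hφ) (ABIdem.valLin k φ hφ x)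
    (h := fun m => ABIdemSpace_le_ABSpace x (ABIdem.valLin_mem m)) m

variable (k φ hφ) in
/-- The projection `m ↦ m 1_x` of `A B` onto `A B 1_x`. -/
def AB.toABIdem (x : G) : AB k φ hφ →ₗ[k] ABIdem k φ hφ x :=
  (LinearMap.mulRight k (idem k x)).restrict fun _ hm => mul_idem_mem_ABIdemSpace hm x

theorem AB.valLin_toABIdem (x : G) (m : AB k φ hφ) :
    ABIdem.valLin k φ hφ x (AB.toABIdem k φ hφ x m) = AB.valLin k φ hφ m * idem k x := rfl

theorem isUnital_ABIdem (x : G) : (ABIdem k φ hφ x).IsUnital := by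
  have h : ABIdemSpace k φ hφ x ≤ (ABIdem k φ hφ x).prodSpan.map (ABIdem.valLin k φ hφ x) :=
    ABIdemSpace_le fun v β => by
      refine ⟨(ABIdem k φ hφ x).act (idem k v) ⟨of k β, of_mem_ABIdemSpace β⟩,
        Submodule.subset_span ⟨_, _, rfl⟩, ?_⟩
      change map k φ hφ (idem k v) * of k β = of k β
      rw [map_idem, idem_mul_of]
  refine eq_top_iff.2 fun m _ => ?_
  obtain ⟨m', hm', e⟩ := h (ABIdem.valLin_mem m)
  rwa [← ABIdem.valLin_injective x e]

theorem homAB_act_apply {u : H} (b : PathAlgebra k G) (f : homAB k φ hφ u) (m : AB k φ hφ) :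
    ((homAB k φ hφ u).act b f).1 m = f.1 (AB.mulRight k φ hφ b m) := rfl

/-- The homomorphism `AB → A 1_u`, `m ↦ E(m b) 1_u`, attached to an element `b` of `B` and to a
homomorphism `E : B → A` of left `A`-modules. -/
def kernelHom {E : PathAlgebra k G →ₗ[k] PathAlgebra k H}
    (hl : ∀ a b, E (map k φ hφ a * b) = a * E b) (u : H) :
    PathAlgebra k G →ₗ[k] homAB k φ hφ u where
  toFun b := ⟨leftIdeal.proj u ∘ₗ E ∘ₗ LinearMap.mulRight k b ∘ₗ AB.valLin k φ hφ, fun a m => by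
    refine leftIdeal.valLin_injective u ?_
    change E (map k φ hφ a * AB.valLin k φ hφ m * b) * idem k u =
      a * (E (AB.valLin k φ hφ m * b) * idem k u)
    rw [mul_assoc, hl, mul_assoc]⟩
  map_add' b b' := by
    refine Subtype.ext (LinearMap.ext fun m => ?_)
    change leftIdeal.proj u (E (_ * (b + b'))) =
      leftIdeal.proj u (E (_ * b)) + leftIdeal.proj u (E (_ * b'))
    rw [mul_add, map_add, map_add]
  map_smul' r b := by
    refine Subtype.ext (LinearMap.ext fun m => ?_)
    change leftIdeal.proj u (E (_ * (r • b))) = r • leftIdeal.proj u (E (_ * b))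
    rw [mul_smul_comm, map_smul, map_smul]

theorem valLin_kernelHom {E : PathAlgebra k G →ₗ[k] PathAlgebra k H}
    (hl : ∀ a b, E (map k φ hφ a * b) = a * E b) (u : H) (b : PathAlgebra k G) (m : AB k φ hφ) :
    leftIdeal.valLin u ((kernelHom hl u b).1 m) = E (AB.valLin k φ hφ m * b) * idem k u := rfl

theorem act_kernelHom {E : PathAlgebra k G →ₗ[k] PathAlgebra k H}
    (hl : ∀ a b, E (map k φ hφ a * b) = a * E b) (u : H) (b b' : PathAlgebra k G) :
    (homAB k φ hφ u).act b (kernelHom hl u b') = kernelHom hl u (b * b') := by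
  refine Subtype.ext (LinearMap.ext fun m => leftIdeal.valLin_injective u ?_)
  rw [homAB_act_apply, valLin_kernelHom, valLin_kernelHom, AB.valLin_mulRight, mul_assoc]

end Modules

/-! ### Dual bases yield the bimodule condition -/

section DualBasisToBimodule

variable {k : Type u} [Field k] {H G : Type u} [Category.{u} H] [Category.{u} G] {φ : H ⥤ G}
  {hφ : Function.Injective φ.obj} {E : PathAlgebra k G →ₗ[k] PathAlgebra k H}
  {x : G} {ι : Type*} [Fintype ι] {u : ι → H} {b c : ι → PathAlgebra k G}

/-- The members `c i` of a dual basis, as elements of `A B 1_x`. -/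
def IsDualBasis.gen (h : IsDualBasis hφ E x u b c) (i : ι) : ABIdem k φ hφ x :=
  ⟨c i, h.right_mem i⟩

theorem IsDualBasis.sum_act_gen (h : IsDualBasis hφ E x u b c) (m : ABIdem k φ hφ x) :
    ∑ i, (ABIdem k φ hφ x).act (E (ABIdem.valLin k φ hφ x m * b i)) (h.gen i) = m := by
  refine ABIdem.valLin_injective x ?_
  rw [map_sum]
  exact h.sum_right _ (ABIdem.valLin_mem m)

theorem IsDualBasis.isFG (h : IsDualBasis hφ E x u b c) : (ABIdem k φ hφ x).IsFG := by
  classical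
  refine ⟨Finset.univ.image h.gen, fun N hN hs => eq_top_iff.2 fun m _ => ?_⟩
  rw [← h.sum_act_gen m]
  exact N.sum_mem fun i _ => hN _ _ (hs _ (Finset.mem_image_of_mem _ (Finset.mem_univ i)))

theorem IsDualBasis.isProjective (h : IsDualBasis hφ E x u b c)
    (hl : ∀ a b, E (map k φ hφ a * b) = a * E b) : (ABIdem k φ hφ x).IsProjective := by
  intro P Q _ _ g hg hsurj f hf
  choose p hp using fun i => hsurj (f (h.gen i))
  refine ⟨{ toFun := fun m => ∑ i, P.act (E (ABIdem.valLin k φ hφ x m * b i)) (p i)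
            map_add' := fun m m' => by
              simp only [map_add, add_mul, LinearMap.add_apply, Finset.sum_add_distrib]
            map_smul' := fun r m => by
              simp only [map_smul, smul_mul_assoc, LinearMap.smul_apply, Finset.smul_sum,
                RingHom.id_apply] }, ?_, ?_⟩
  · intro r m
    change ∑ i, P.act (E (map k φ hφ r * ABIdem.valLin k φ hφ x m * b i)) (p i) =
      P.act r (∑ i, P.act (E (ABIdem.valLin k φ hφ x m * b i)) (p i))
    rw [map_sum]
    refine Finset.sum_congr rfl fun i _ => ?_
    rw [mul_assoc, hl, map_mul]
    rfl
  · refine LinearMap.ext fun m => ?_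
    change g (∑ i, P.act (E (ABIdem.valLin k φ hφ x m * b i)) (p i)) = f m
    conv_rhs => rw [← h.sum_act_gen m]
    rw [map_sum, map_sum]
    refine Finset.sum_congr rfl fun i _ => ?_
    rw [hg, hp, hf]

end DualBasisToBimodule

section DualBasisToBimodule

variable {k : Type u} [Field k] {H G : Type u} [Category.{u} H] [Category.{u} G] {φ : H ⥤ G}
  {hφ : Function.Injective φ.obj} {E : PathAlgebra k G →ₗ[k] PathAlgebra k H}

theorem mul_idem_of_bimodule (hr : ∀ a b, E (b * map k φ hφ a) = E b * a) {u : H}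
    (m : PathAlgebra k G) (b : leftIdeal k (φ.obj u)) :
    E (m * leftIdeal.valLin _ b) * idem k u = E (m * leftIdeal.valLin _ b) := by
  rw [← hr, map_idem, mul_assoc, leftIdeal.valLin_mul_idem]

/-- The homomorphism `B 1_u → B Hom_A(AB, A 1_u)`, `b ↦ (m ↦ E(m b))`. -/
def kernelToBHomAB (hl : ∀ a b, E (map k φ hφ a * b) = a * E b) (u : H) :
    leftIdeal k (φ.obj u) →ₗ[k] BHomAB k φ hφ u :=
  LinearMap.codRestrict (homAB k φ hφ u).prodSpan (kernelHom hl u ∘ₗ leftIdeal.valLin (φ.obj u))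
    fun b => Submodule.subset_span ⟨leftIdeal.valLin _ b, kernelHom hl u (idem k (φ.obj u)), by
      rw [act_kernelHom, leftIdeal.valLin_mul_idem]; rfl⟩

theorem valLin_eval_kernelToBHomAB (hl : ∀ a b, E (map k φ hφ a * b) = a * E b)
    (hr : ∀ a b, E (b * map k φ hφ a) = E b * a) {u : H} (b : leftIdeal k (φ.obj u))
    (m : AB k φ hφ) :
    leftIdeal.valLin u (BHomAB.eval (kernelToBHomAB hl u b) m) =
      E (AB.valLin k φ hφ m * leftIdeal.valLin _ b) :=
  mul_idem_of_bimodule hr _ b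

theorem kernelToBHomAB_bijective (hl : ∀ a b, E (map k φ hφ a * b) = a * E b)
    (hr : ∀ a b, E (b * map k φ hφ a) = E b * a)
    (hdual : ∀ x : G, ∃ (N : ℕ) (u : Fin N → H) (b c : Fin N → PathAlgebra k G),
      IsDualBasis hφ E x u b c) (u : H) :
    Function.Bijective (kernelToBHomAB hl u) := by
  refine ⟨(injective_iff_map_eq_zero _).2 fun b hb => ?_, ?_⟩
  · have hE (m : AB k φ hφ) : E (AB.valLin k φ hφ m * leftIdeal.valLin _ b) = 0 := by
      rw [← valLin_eval_kernelToBHomAB hl hr, hb]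
      rfl
    refine leftIdeal.valLin_injective _ (eq_zero_of_idem_mul fun x => ?_)
    obtain ⟨N, w, d, c, h⟩ := hdual x
    rw [← leftIdeal.valLin_mul_idem, ← h.sum_left]
    refine Finset.sum_eq_zero fun i _ => ?_
    rw [leftIdeal.valLin_mul_idem]
    erw [hE (ABIdem.toAB k φ hφ x (h.gen i))]
    rw [map_zero, mul_zero]
  · suffices (homAB k φ hφ u).prodSpan ≤
        LinearMap.range (kernelHom hl u ∘ₗ leftIdeal.valLin (φ.obj u)) by
      rintro ⟨f, hf⟩
      obtain ⟨b, hb⟩ := this hf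
      exact ⟨b, Subtype.ext hb⟩
    refine Submodule.span_le.2 ?_
    rintro _ ⟨r, f, rfl⟩
    change _ ∈ LinearMap.range (kernelHom hl u ∘ₗ leftIdeal.valLin (φ.obj u))
    induction r using induction_linear with
    | zero => rw [map_zero]; exact Submodule.zero_mem _
    | add r s hr hs => rw [map_add]; exact Submodule.add_mem _ hr hs
    | smul_of t y x a =>
      rw [map_smul]
      refine Submodule.smul_mem _ _ ?_
      -- the homomorphism `a f` vanishes outside of `A B 1_x`, so the dual basis at `x` suffices
      obtain ⟨N, w, d, c, h⟩ := hdual x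
      let g (i) : leftIdeal k u :=
        f.1 (AB.mulRight k φ hφ (of k a) (ABIdem.toAB k φ hφ x (h.gen i)))
      refine ⟨leftIdeal.proj _ (∑ i, d i * map k φ hφ (leftIdeal.valLin u (g i))), ?_⟩
      refine Subtype.ext (LinearMap.ext fun m => leftIdeal.valLin_injective u ?_)
      rw [homAB_act_apply, LinearMap.comp_apply, valLin_kernelHom, mul_idem_of_bimodule hr,
        leftIdeal.valLin_proj, Finset.sum_mul, Finset.mul_sum, map_sum]
      have hm : AB.mulRight k φ hφ (of k a) m = ∑ i, (AB k φ hφ).act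
          (E (ABIdem.valLin k φ hφ x (AB.toABIdem k φ hφ x m) * d i))
            (AB.mulRight k φ hφ (of k a) (ABIdem.toAB k φ hφ x (h.gen i))) := by
        refine AB.valLin_injective ?_
        have h₁ := congrArg (ABIdem.valLin k φ hφ x) (h.sum_act_gen (AB.toABIdem k φ hφ x m))
        rw [AB.valLin_toABIdem, map_sum] at h₁
        rw [AB.valLin_mulRight, ← idem_mul_of a, ← mul_assoc, ← h₁, map_sum, Finset.sum_mul]
        refine Finset.sum_congr rfl fun i _ => ?_
        rw [AB.valLin_act, AB.valLin_mulRight, ABIdem.valLin_act, ABIdem.valLin_toAB, mul_assoc,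
          idem_mul_of]
        rfl
      rw [hm, map_sum, map_sum]
      refine Finset.sum_congr rfl fun i _ => ?_
      rw [f.2, leftIdeal.valLin_act, mul_assoc, ← map_idem φ hφ, ← map_mul,
        leftIdeal.valLin_mul_idem, ← mul_assoc, hr, AB.valLin_toABIdem, mul_assoc _ (idem k x),
        h.idem_mul_left]

theorem bimoduleCondition_of_isDualBasis (hl : ∀ a b, E (map k φ hφ a * b) = a * E b)
    (hr : ∀ a b, E (b * map k φ hφ a) = E b * a)
    (hdual : ∀ x : G, ∃ (N : ℕ) (u : Fin N → H) (b c : Fin N → PathAlgebra k G),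
      IsDualBasis hφ E x u b c) : BimoduleCondition k φ hφ := by
  refine ⟨fun x => ?_, fun u => LinearEquiv.ofBijective _ (kernelToBHomAB_bijective hl hr hdual u),
    fun u b m => Subtype.ext ?_, fun u u' h b m => ?_⟩
  · obtain ⟨N, u, b, c, h⟩ := hdual x
    exact ⟨isUnital_ABIdem x, h.isFG, h.isProjective hl⟩
  · exact (act_kernelHom hl u b (leftIdeal.valLin _ m)).symm
  · refine leftIdeal.valLin_injective _ ?_
    rw [leftIdeal.valLin_mulArrow]
    simp only [LinearEquiv.ofBijective_apply]
    rw [valLin_eval_kernelToBHomAB hl hr, valLin_eval_kernelToBHomAB hl hr,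
      leftIdeal.valLin_mulArrow, ← map_of φ hφ, ← mul_assoc, hr]

end DualBasisToBimodule

/-! ### The bimodule condition yields dual bases -/

section Projective

variable {k : Type u} [Field k] {C : Type u} [Category.{u} C]

variable (k C) in
/-- The free module `R ^ ι` over the path algebra `R`. -/
def freeMod (ι : Type u) : LeftMod k (PathAlgebra k C) where
  carrier := ι → PathAlgebra k C
  act :=
    { toFun := fun r => LinearMap.pi fun i => LinearMap.mulLeft k r ∘ₗ LinearMap.proj i
      map_smul' := fun c r => LinearMap.ext fun f => funext fun i => smul_mul_assoc c r (f i)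
      map_zero' := LinearMap.ext fun f => funext fun i => zero_mul (f i)
      map_add' := fun r s => LinearMap.ext fun f => funext fun i => add_mul r s (f i)
      map_mul' := fun r s => LinearMap.ext fun f => funext fun i => mul_assoc r s (f i) }

/-- The coordinates on the free module. -/
def freeMod.coord {ι : Type u} (i : ι) : freeMod k C ι →ₗ[k] PathAlgebra k C := LinearMap.proj i

theorem freeMod.coord_act {ι : Type u} (i : ι) (r : PathAlgebra k C) (f : freeMod k C ι) :
    freeMod.coord i ((freeMod k C ι).act r f) = r * freeMod.coord i f := rfl

/-- The inclusion of a summand of the free module. -/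
def freeMod.single {ι : Type u} [DecidableEq ι] (i : ι) : PathAlgebra k C →ₗ[k] freeMod k C ι :=
  LinearMap.single k (fun _ => PathAlgebra k C) i

theorem freeMod.ext {ι : Type u} {f g : freeMod k C ι}
    (h : ∀ i, freeMod.coord i f = freeMod.coord i g) : f = g :=
  funext h

theorem freeMod.coord_single {ι : Type u} [DecidableEq ι] (i j : ι) (a : PathAlgebra k C) :
    freeMod.coord j (freeMod.single i a) = if j = i then a else 0 :=
  (Pi.single_apply i a j)

theorem freeMod.act_single {ι : Type u} [DecidableEq ι] (i : ι) (r a : PathAlgebra k C) :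
    (freeMod k C ι).act r (freeMod.single i a) = freeMod.single i (r * a) := by
  refine freeMod.ext fun j => ?_
  rw [freeMod.coord_act, freeMod.coord_single, freeMod.coord_single, mul_ite, mul_zero]

theorem freeMod.isUnital (ι : Type u) [Fintype ι] : (freeMod k C ι).IsUnital := by
  classical
  refine eq_top_iff.2 fun f _ => ?_
  have hf : f = ∑ i, freeMod.single i (freeMod.coord i f) := by
    refine freeMod.ext fun j => ?_
    simp [freeMod.coord_single]
  rw [hf]
  refine Submodule.sum_mem _ fun i _ => ?_
  obtain ⟨S, hS⟩ := exists_sum_idem_mul (freeMod.coord i f)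
  exact Submodule.subset_span ⟨∑ y ∈ S, idem k y, freeMod.single i (freeMod.coord i f), by
    rw [freeMod.act_single, hS S subset_rfl]⟩

/-- A finitely generated projective unital module over a path algebra has dual bases, provided its
elements have local units. -/
theorem exists_dual_coordinates {M : LeftMod k (PathAlgebra k C)} (hu : M.IsUnital)
    (hfg : M.IsFG) (hp : M.IsProjective) (hloc : ∀ m : M, ∃ r, M.act r m = m) :
    ∃ (s : Finset M) (γ : s → M →ₗ[k] PathAlgebra k C),
      (∀ i r m, γ i (M.act r m) = r * γ i m) ∧ ∀ m, ∑ i, M.act (γ i m) i.1 = m := by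
  classical
  obtain ⟨s, hs⟩ := hfg
  let g : freeMod k C s →ₗ[k] M :=
    { toFun := fun f => ∑ i : s, M.act (freeMod.coord i f) i.1
      map_add' := fun f f' => by
        simp only [map_add, LinearMap.add_apply, Finset.sum_add_distrib]
      map_smul' := fun r f => by
        simp only [map_smul, LinearMap.smul_apply, Finset.smul_sum, RingHom.id_apply] }
  have g_apply (f) : g f = ∑ i : s, M.act (freeMod.coord i f) i.1 := rfl
  have hg : g ∈ LeftMod.homs (freeMod k C s) M := by
    intro r f
    simp only [g_apply, freeMod.coord_act, map_mul, map_sum]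
    rfl
  have hsurj : Function.Surjective g := by
    rw [← LinearMap.range_eq_top]
    refine hs _ ?_ fun m hm => ?_
    · rintro r _ ⟨f, rfl⟩
      exact ⟨_, hg r f⟩
    · obtain ⟨r, hr⟩ := hloc m
      refine ⟨freeMod.single ⟨m, hm⟩ r, ?_⟩
      rw [g_apply, Finset.sum_eq_single ⟨m, hm⟩, freeMod.coord_single, if_pos rfl, hr]
      · intro i _ hi
        rw [freeMod.coord_single, if_neg hi, map_zero, LinearMap.zero_apply]
      · simp
  obtain ⟨f, hf, hgf⟩ := hp _ M (freeMod.isUnital s) hu g hg hsurj LinearMap.id fun _ _ => rfl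
  refine ⟨s, fun i => freeMod.coord i ∘ₗ f, fun i r m => ?_, fun m => ?_⟩
  · rw [LinearMap.comp_apply, hf, freeMod.coord_act]
    rfl
  · exact congrArg (fun q => q m) hgf

end Projective

section BimoduleToDualBasis

variable {k : Type u} [Field k] {H G : Type u} [Category.{u} H] [Category.{u} G] {φ : H ⥤ G}
  {hφ : Function.Injective φ.obj}

variable (k φ hφ) in
/-- The identity of `φ v`, as an element of `A B`. -/
def AB.one (v : H) : AB k φ hφ :=
  ⟨idem k (φ.obj v), ABIdemSpace_le_ABSpace _ (of_mem_ABIdemSpace (𝟙 (φ.obj v)))⟩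

theorem AB.valLin_one (v : H) : AB.valLin k φ hφ (AB.one k φ hφ v) = idem k (φ.obj v) := rfl

variable {Φ : ∀ u : H, leftIdeal k (φ.obj u) ≃ₗ[k] BHomAB k φ hφ u}

variable (Φ) in
/-- The value of `Φ u (b 1_u)` at `m`, as an element of `A`. -/
def evalIso (u : H) (b : PathAlgebra k G) (m : AB k φ hφ) : PathAlgebra k H :=
  leftIdeal.valLin u (BHomAB.eval (Φ u (leftIdeal.proj _ b)) m)

theorem evalIso_act (u : H) (b : PathAlgebra k G) (r : PathAlgebra k H) (m : AB k φ hφ) :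
    evalIso Φ u b ((AB k φ hφ).act r m) = r * evalIso Φ u b m :=
  congrArg (leftIdeal.valLin u) ((Φ u (leftIdeal.proj _ b)).1.2 r m)

theorem evalIso_mul_idem (u : H) (b : PathAlgebra k G) (m : AB k φ hφ) :
    evalIso Φ u b m * idem k u = evalIso Φ u b m :=
  leftIdeal.valLin_mul_idem _

variable (Φ) in
/-- The map `evalIso` is linear in both arguments. -/
def evalIsoLin (u : H) : PathAlgebra k G →ₗ[k] AB k φ hφ →ₗ[k] PathAlgebra k H where
  toFun b := leftIdeal.valLin u ∘ₗ (Φ u (leftIdeal.proj _ b)).1.1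
  map_add' b b' := by rw [map_add, map_add]; rfl
  map_smul' r b := by rw [map_smul, map_smul]; rfl

theorem evalIsoLin_apply (u : H) (b : PathAlgebra k G) (m : AB k φ hφ) :
    evalIsoLin Φ u b m = evalIso Φ u b m := rfl

theorem evalIso_mul
    (hΦ : ∀ u : H, (Φ u).toLinearMap ∈ LeftMod.homs (leftIdeal k (φ.obj u)) (BHomAB k φ hφ u))
    (u : H) (b b' : PathAlgebra k G) (m : AB k φ hφ) :
    evalIso Φ u (b * b') m = evalIso Φ u b' (AB.mulRight k φ hφ b m) := by
  have h : leftIdeal.proj (φ.obj u) (b * b') =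
      (leftIdeal k (φ.obj u)).act b (leftIdeal.proj _ b') :=
    leftIdeal.valLin_injective _ (mul_assoc b b' _)
  have h' := hΦ u b (leftIdeal.proj _ b')
  rw [← h] at h'
  exact congrArg (fun f : BHomAB k φ hφ u => leftIdeal.valLin u (BHomAB.eval f m)) h'

theorem evalIso_injective {u : H} {b : PathAlgebra k G} (h : ∀ m, evalIso Φ u b m = 0) :
    b * idem k (φ.obj u) = 0 := by
  have : Φ u (leftIdeal.proj _ b) = 0 :=
    Subtype.ext (Subtype.ext (LinearMap.ext fun m => leftIdeal.valLin_injective _ (h m)))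
  rw [map_eq_zero_iff _ (Φ u).injective] at this
  exact congrArg (leftIdeal.valLin _) this

variable (Φ) in
/-- The family `E(p) = Φ(p)(1)` attached to the isomorphisms `Φ`. -/
def kernelOfIso (u v : H) (p : φ.obj u ⟶ φ.obj v) : (u ⟶ v) →₀ k :=
  coeff u v (evalIso Φ u (of k p) (AB.one k φ hφ v))

theorem idem_mul_evalIso_one (u v : H) (b : PathAlgebra k G) :
    idem k v * evalIso Φ u b (AB.one k φ hφ v) = evalIso Φ u b (AB.one k φ hφ v) := by
  rw [← evalIso_act]
  congr 1
  refine AB.valLin_injective ?_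
  rw [AB.valLin_act, AB.valLin_one, map_idem, idem_mul_idem]

theorem homEmb_kernelOfIso (u v : H) (p : φ.obj u ⟶ φ.obj v) :
    homEmb (kernelOfIso Φ u v p) = evalIso Φ u (of k p) (AB.one k φ hφ v) := by
  rw [kernelOfIso, homEmb_coeff, idem_mul_evalIso_one, evalIso_mul_idem]

theorem isBinatural_kernelOfIso
    (hΦ : ∀ u : H, (Φ u).toLinearMap ∈ LeftMod.homs (leftIdeal k (φ.obj u)) (BHomAB k φ hφ u))
    (hnat : ∀ (u u' : H) (h : u' ⟶ u) (b : leftIdeal k (φ.obj u)) (m : AB k φ hφ),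
      BHomAB.eval (Φ u' (leftIdeal.mulArrow k (φ.map h) b)) m =
        leftIdeal.mulArrow k h (BHomAB.eval (Φ u b) m)) :
    IsBinatural (kernelOfIso Φ) := by
  intro u v u' v' h h' p
  refine homEmb_injective ?_
  rw [homEmb_mapDomain, homEmb_kernelOfIso, homEmb_kernelOfIso]
  have h₁ : leftIdeal.proj (φ.obj u') (of k (φ.map h ≫ p ≫ φ.map h')) =
      leftIdeal.mulArrow k (φ.map h) (leftIdeal.proj _ (of k (p ≫ φ.map h'))) := by
    refine leftIdeal.valLin_injective _ ?_
    rw [leftIdeal.valLin_mulArrow, leftIdeal.valLin_proj, leftIdeal.valLin_proj, of_mul_idem,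
      of_mul_idem, of_mul_of]
  have h₂ : AB.mulRight k φ hφ (of k (φ.map h')) (AB.one k φ hφ v') =
      (AB k φ hφ).act (of k h') (AB.one k φ hφ v) := by
    refine AB.valLin_injective ?_
    rw [AB.valLin_act, AB.valLin_mulRight, AB.valLin_one, AB.valLin_one, map_of, idem_mul_of,
      of_mul_idem]
  rw [evalIso, h₁, hnat, leftIdeal.valLin_mulArrow, ← evalIso, ← of_mul_of, evalIso_mul hΦ, h₂,
    evalIso_act]

/-- The isomorphisms `Φ` are given by `b ↦ (m ↦ E(m b))`. -/
theorem evalIso_eq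
    (hΦ : ∀ u : H, (Φ u).toLinearMap ∈ LeftMod.homs (leftIdeal k (φ.obj u)) (BHomAB k φ hφ u))
    (u : H) (b : PathAlgebra k G) (m : AB k φ hφ) :
    evalIso Φ u b m =
      extendKernel (kernelOfIso Φ) (AB.valLin k φ hφ m * (b * idem k (φ.obj u))) := by
  have hone (v : H) (b : PathAlgebra k G) : evalIso Φ u b (AB.one k φ hφ v) =
      extendKernel (kernelOfIso Φ) (idem k (φ.obj v) * (b * idem k (φ.obj u))) := by
    induction b using induction_linear with
    | zero => rw [← evalIsoLin_apply]; simp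
    | add b b' hb hb' =>
      rw [← evalIsoLin_apply] at hb hb' ⊢
      rw [map_add, LinearMap.add_apply, hb, hb', add_mul, mul_add, map_add]
    | smul_of r x y p =>
      rw [← evalIsoLin_apply, map_smul, LinearMap.smul_apply, smul_mul_assoc, mul_smul_comm,
        map_smul, evalIsoLin_apply]
      congr 1
      by_cases hx : φ.obj u = x
      · subst hx
        rw [of_mul_idem]
        by_cases hy : y = φ.obj v
        · subst hy
          rw [idem_mul_of, extendKernel_of hφ, homEmb_kernelOfIso]
        · have h₀ : AB.mulRight k φ hφ (idem k y) (AB.one k φ hφ v) = 0 := by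
            refine AB.valLin_injective ?_
            rw [AB.valLin_mulRight, AB.valLin_one, map_zero]
            exact of_mul_idem_ne _ hy
          rw [idem_mul_of_ne _ hy, map_zero, ← idem_mul_of p, evalIso_mul hΦ, h₀,
            ← evalIsoLin_apply, map_zero]
      · have h₀ : leftIdeal.proj (φ.obj u) (of k p) = 0 := by
          refine leftIdeal.valLin_injective _ ?_
          rw [leftIdeal.valLin_proj, of_mul_idem_ne _ hx, map_zero]
        rw [of_mul_idem_ne _ hx, mul_zero, map_zero, evalIso, h₀, map_zero]
        rfl
  obtain ⟨S, hS⟩ := exists_sum_idem_mul_of_mem_ABSpace (AB.valLin_mem m)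
  have hm : m = ∑ v ∈ S, AB.mulRight k φ hφ (AB.valLin k φ hφ m) (AB.one k φ hφ v) := by
    refine AB.valLin_injective ?_
    rw [map_sum]
    simp only [AB.valLin_mulRight, AB.valLin_one]
    rw [← Finset.sum_mul, hS S subset_rfl]
  conv_lhs => rw [hm, ← evalIsoLin_apply, map_sum]
  conv_rhs => rw [← hS S subset_rfl, Finset.sum_mul, Finset.sum_mul, map_sum]
  refine Finset.sum_congr rfl fun v _ => ?_
  rw [evalIsoLin_apply, ← evalIso_mul hΦ, hone, mul_assoc, mul_assoc]

theorem exists_isDualBasis_of_iso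
    (hΦ : ∀ u : H, (Φ u).toLinearMap ∈ LeftMod.homs (leftIdeal k (φ.obj u)) (BHomAB k φ hφ u))
    (hE : IsBinatural (kernelOfIso Φ)) (x : G) (hfg : (ABIdem k φ hφ x).IsFG)
    (hp : (ABIdem k φ hφ x).IsProjective) :
    ∃ (ι : Type u) (_ : Fintype ι) (u : ι → H) (b c : ι → PathAlgebra k G),
      IsDualBasis hφ (extendKernel (kernelOfIso Φ)) x u b c := by
  have hloc (m : ABIdem k φ hφ x) : ∃ S : Finset H,
      (∑ v ∈ S, idem k (φ.obj v)) * ABIdem.valLin k φ hφ x m = ABIdem.valLin k φ hφ x m := by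
    obtain ⟨S, hS⟩ := exists_sum_idem_mul_of_mem_ABSpace
      (ABIdemSpace_le_ABSpace x (ABIdem.valLin_mem m))
    exact ⟨S, hS S subset_rfl⟩
  choose S hS using hloc
  obtain ⟨s, γ, hγ, hsum⟩ := exists_dual_coordinates (isUnital_ABIdem x) hfg hp fun m =>
    ⟨∑ v ∈ S m, idem k v, ABIdem.valLin_injective x (by
      rw [ABIdem.valLin_act, map_sum]
      simp only [map_idem, hS])⟩
  -- the component at `v` of a coordinate on `A B 1_x`, extended by zero to `A B`
  let F (i : s) (v : H) : homAB k φ hφ v :=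
    ⟨leftIdeal.proj v ∘ₗ γ i ∘ₗ AB.toABIdem k φ hφ x, fun r m => by
      have h : AB.toABIdem k φ hφ x ((AB k φ hφ).act r m) =
          (ABIdem k φ hφ x).act r (AB.toABIdem k φ hφ x m) := by
        refine ABIdem.valLin_injective x ?_
        rw [AB.valLin_toABIdem, ABIdem.valLin_act, AB.valLin_act, AB.valLin_toABIdem, mul_assoc]
      refine leftIdeal.valLin_injective v ?_
      rw [LinearMap.comp_apply, LinearMap.comp_apply, h, hγ, leftIdeal.valLin_act,
        leftIdeal.valLin_proj, mul_assoc]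
      rfl⟩
  have hF (i : s) (v : H) : F i v ∈ (homAB k φ hφ v).prodSpan := by
    refine Submodule.subset_span ⟨idem k x, F i v, Subtype.ext (LinearMap.ext fun m => ?_)⟩
    rw [homAB_act_apply]
    change leftIdeal.proj v (γ i (AB.toABIdem k φ hφ x (AB.mulRight k φ hφ (idem k x) m))) =
      leftIdeal.proj v (γ i (AB.toABIdem k φ hφ x m))
    congr 2
    refine ABIdem.valLin_injective x ?_
    rw [AB.valLin_toABIdem, AB.valLin_toABIdem, AB.valLin_mulRight, mul_assoc, idem_mul_idem]
  let b₀ (i : s) (v : H) : leftIdeal k (φ.obj v) := (Φ v).symm ⟨F i v, hF i v⟩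
  let b (j : Σ i : s, S i.1) : PathAlgebra k G := idem k x * leftIdeal.valLin _ (b₀ j.1 j.2.1)
  let c (j : Σ i : s, S i.1) : PathAlgebra k G :=
    idem k (φ.obj j.2.1) * ABIdem.valLin k φ hφ x j.1.1
  have hb (j) : b j * idem k (φ.obj j.2.1) = b j := by
    rw [mul_assoc, leftIdeal.valLin_mul_idem]
  have hxb (j) : idem k x * b j = b j := by
    rw [← mul_assoc, idem_mul_idem]
  have hval (j) (m : ABIdem k φ hφ x) :
      extendKernel (kernelOfIso Φ) (ABIdem.valLin k φ hφ x m * b j) =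
        γ j.1 m * idem k j.2.1 := by
    have h₁ := evalIso_eq hΦ j.2.1 (leftIdeal.valLin _ (b₀ j.1 j.2.1)) (ABIdem.toAB k φ hφ x m)
    have h₂ : Φ _ (b₀ j.1 j.2.1) = ⟨F j.1 j.2.1, hF j.1 j.2.1⟩ := (Φ _).apply_symm_apply _
    rw [evalIso, leftIdeal.proj_valLin, leftIdeal.valLin_mul_idem, h₂,
      ABIdem.valLin_toAB] at h₁
    rw [← mul_assoc, mul_idem_of_mem_ABIdemSpace (ABIdem.valLin_mem m), ← h₁]
    change γ j.1 (AB.toABIdem k φ hφ x (ABIdem.toAB k φ hφ x m)) * idem k j.2.1 = _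
    congr 2
    refine ABIdem.valLin_injective x ?_
    rw [AB.valLin_toABIdem, ABIdem.valLin_toAB, mul_idem_of_mem_ABIdemSpace (ABIdem.valLin_mem m)]
  have hright (m) (hm : m ∈ ABIdemSpace k φ hφ x) :
      ∑ j, map k φ hφ (extendKernel (kernelOfIso Φ) (m * b j)) * c j = m := by
    let m' : ABIdem k φ hφ x := ⟨m, hm⟩
    have h₁ := congrArg (ABIdem.valLin k φ hφ x) (hsum m')
    rw [map_sum] at h₁
    refine Eq.trans ?_ h₁
    rw [Fintype.sum_sigma]
    refine Finset.sum_congr rfl fun i _ => ?_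
    rw [ABIdem.valLin_act, ← hS i.1, Finset.sum_mul, Finset.mul_sum, ← Finset.sum_coe_sort (S i.1)]
    refine Finset.sum_congr rfl fun v _ => ?_
    have h₂ := hval ⟨i, v⟩ m'
    change extendKernel (kernelOfIso Φ) (m * b ⟨i, v⟩) = _ at h₂
    rw [h₂, map_mul, map_idem, mul_assoc, ← mul_assoc (idem k _) (idem k _), idem_mul_idem]
  refine ⟨Σ i : s, S i.1, inferInstance, fun j => j.2.1, b, c, hxb, hb, fun j => ?_, fun j => ?_,
    hright, fun v b' => ?_⟩
  · rw [← mul_assoc, idem_mul_idem]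
  · have h := ((ABIdem k φ hφ x).act (idem k j.2.1) j.1.1).2
    change map k φ hφ (idem k j.2.1) * ABIdem.valLin k φ hφ x j.1.1 ∈ ABIdemSpace k φ hφ x at h
    rwa [map_idem] at h
  · -- both sides have the same image under the injective map `Φ v`
    have hl := extendKernel_map_mul (hφ := hφ) hE
    have hr := extendKernel_mul_map (hφ := hφ) hE
    set β := b' * idem k (φ.obj v) with hβ
    have hβv : β * idem k (φ.obj v) = β := by rw [hβ, mul_assoc, idem_mul_idem]
    have hD : (∑ j, b j * map k φ hφ (extendKernel (kernelOfIso Φ) (c j * β)) - idem k x * β) *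
        idem k (φ.obj v) =
          ∑ j, b j * map k φ hφ (extendKernel (kernelOfIso Φ) (c j * β)) - idem k x * β := by
      rw [sub_mul, Finset.sum_mul, mul_assoc, hβv]
      congr 1
      refine Finset.sum_congr rfl fun j _ => ?_
      rw [mul_assoc (b j), ← map_idem φ hφ, ← map_mul, ← hr, map_idem, mul_assoc (c j), hβv]
    rw [← sub_eq_zero, ← hD]
    refine evalIso_injective (Φ := Φ) fun m => ?_
    rw [evalIso_eq hΦ, hD, mul_sub, map_sub, sub_eq_zero, Finset.mul_sum, map_sum,
      ← mul_assoc _ (idem k x), ← hright _ (mul_idem_mem_ABIdemSpace (AB.valLin_mem m) x),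
      Finset.sum_mul, map_sum]
    refine Finset.sum_congr rfl fun j _ => ?_
    rw [← mul_assoc, hr, mul_assoc (map k φ hφ _), hl, mul_assoc _ (idem k x), hxb]

end BimoduleToDualBasis

/-- The bimodule condition is equivalent to the existence of dual bases. -/
theorem bimoduleCondition_iff_hasDualBases {k : Type u} [Field k] {H G : Type u} [Category.{u} H]
    [Groupoid.{u} G] {φ : H ⥤ G} (hφ : Function.Injective φ.obj) :
    BimoduleCondition k φ hφ ↔ HasDualBases k φ := by
  constructor
  · rintro ⟨hA, Φ, hΦ, hnat⟩
    have hE := isBinatural_kernelOfIso hΦ hnat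
    refine ⟨kernelOfIso Φ, hE, fun x => ?_⟩
    obtain ⟨ι, _, u, b, c, h⟩ := exists_isDualBasis_of_iso hΦ hE x (hA x).2.1 (hA x).2.2
    exact h.exists_arrows
  · rintro ⟨E, hE, hdual⟩
    have hE : IsBinatural E := hE
    refine bimoduleCondition_of_isDualBasis (extendKernel_map_mul hE) (extendKernel_mul_map hE)
      fun x => ?_
    obtain ⟨N, u, b, c, h⟩ := hdual x
    -- an arrow and its inverse exist simultaneously, so both identities hold for all arrows
    exact ⟨N, u, _, _, isDualBasis_of_arrows (fun v β => (h v β (Groupoid.inv β)).1)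
      fun v β => (h v (Groupoid.inv β) β).2⟩

end PathAlgebra

end

theorem mainTheorem1 (k : Type u) [Field k] (H G : Type u) [Groupoid.{u} H] [Groupoid.{u} G]
    (φ : H ⥤ G) (hφ : Function.Injective φ.obj) :
    List.TFAE
      [IsFrobeniusMorphism k φ,
       HasDualBases k φ,
       PathAlgebra.BimoduleCondition k φ hφ] := by
  tfae_have 1 → 2 := IsFrobeniusMorphism.hasDualBases
  tfae_have 2 → 1 := HasDualBases.isFrobeniusMorphism
  tfae_have 3 ↔ 2 := PathAlgebra.bimoduleCondition_iff_hasDualBases hφ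
  tfae_finish
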